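/- Let $\mathbb{K}$ be a field of characteristic zero. Let $W$ be the Witt algebra, i.e. the Lie algebra over $\mathbb{K}$ with basis $\{e_n : n\in\mathbb{Z}\}$ and bracket $[e_i,e_j]=(j-i)e_{i+j}$; let $W_+$ be the Lie subalgebra of $W$ spanned by $\{e_n : n\ge 1\}$; and let $Vir$ be the Virasoro algebra, i.e. the Lie algebra over $\mathbb{K}$ with basis $\{e_n : n\in\mathbb{Z}\}\cup\{c\}$, where $c$ is central and $$[e_i,e_j]=(j-i)e_{i+j}+\frac{i^3-i}{12}\,\delta_{i+j,0}\,c .$$ For a Lie algebra $\mathfrak{g}$ let $U(\mathfrak g)$ denote its universal enveloping algebra. A two-sided ideal $P$ of a ring $R$ is completely prime if $P\neq R$ and $ab\in P$ implies $a\in P$ or $b\in P$ (equivalently, $R/P$ is a domain). Then $U(W_+)$, $U(W)$ and $U(Vir)$ satisfy the ascending chain condition on completely prime ideals: for each of these rings, every ascending chain $P_0\subseteq P_1\subseteq P_2\subseteq\cdots$ of completely prime ideals is eventually constant. -/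

import Mathlib

/-! ## The ascending chain condition on completely prime ideals -/

/-- A two-sided ideal `P` of a ring `R` is completely prime if it is proper and
`a * b ∈ P` implies `a ∈ P` or `b ∈ P`; that is, if `R / P` is a (not necessarily commutative)
domain. -/
structure IsCompletelyPrime {R : Type*} [Ring R] (P : TwoSidedIdeal R) : Prop where
  ne_top : P ≠ ⊤
  mem_or_mem : ∀ {a b : R}, a * b ∈ P → a ∈ P ∨ b ∈ P

/-- `R` satisfies the ascending chain condition on completely prime ideals: every ascending chain
`P 0 ⊆ P 1 ⊆ P 2 ⊆ ⋯` of completely prime two-sided ideals of `R` stabilises. -/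
def ACCCompletelyPrime (R : Type*) [Ring R] : Prop :=
  ∀ P : ℕ → TwoSidedIdeal R, Monotone P → (∀ n, IsCompletelyPrime (P n)) →
    ∃ N, ∀ n, N ≤ n → P n = P N

/-! ## The Witt algebra -/

/-- The Witt algebra `W` over `K`: the `K`-vector space with basis `e n`, `n : ℤ`, and bracket
`⁅e i, e j⁆ = (j - i) • e (i + j)`. -/
def WittAlgebra (K : Type*) [Field K] : Type _ := ℤ →₀ K

namespace WittAlgebra

section

variable {K : Type*} [Field K]

noncomputable instance : AddCommGroup (WittAlgebra K) := inferInstanceAs (AddCommGroup (ℤ →₀ K))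

noncomputable instance : Module K (WittAlgebra K) := inferInstanceAs (Module K (ℤ →₀ K))

variable (K) in
/-- The standard basis `e n`, `n : ℤ`, of the Witt algebra. -/
noncomputable def basis : Module.Basis ℤ K (WittAlgebra K) := ⟨LinearEquiv.refl K (ℤ →₀ K)⟩

variable (K) in
/-- The standard basis vector `e n`. -/
noncomputable def e (n : ℤ) : WittAlgebra K := basis K n

theorem induction_e {p : WittAlgebra K → Prop} (zero : p 0)
    (add : ∀ x y, p x → p y → p (x + y)) (smul : ∀ (r : K) x, p x → p (r • x))
    (e : ∀ n, p (e K n)) (x : WittAlgebra K) : p x := by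
  have hx : x ∈ Submodule.span K (Set.range (basis K)) := (basis K).mem_span x
  induction hx using Submodule.span_induction with
  | mem x h => obtain ⟨n, rfl⟩ := h; exact e n
  | zero => exact zero
  | add x y _ _ hx hy => exact add x y hx hy
  | smul r x _ hx => exact smul r x hx

variable (K) in
/-- The bracket of the Witt algebra, as a bilinear map. -/
noncomputable def bracketAux : WittAlgebra K →ₗ[K] WittAlgebra K →ₗ[K] WittAlgebra K :=
  (basis K).constr K fun i => (basis K).constr K fun j => ((j : K) - (i : K)) • e K (i + j)

theorem bracketAux_e (i j : ℤ) :
    bracketAux K (e K i) (e K j) = ((j : K) - (i : K)) • e K (i + j) := by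
  simp only [bracketAux, e, Module.Basis.constr_basis]

theorem bracketAux_skew (x y : WittAlgebra K) : bracketAux K x y = -bracketAux K y x := by
  induction x using induction_e with
  | zero => simp
  | add x x' hx hx' => simp only [map_add, LinearMap.add_apply, hx, hx', neg_add]
  | smul r x hx => simp only [map_smul, LinearMap.smul_apply, hx, smul_neg]
  | e i =>
  induction y using induction_e with
  | zero => simp
  | add x x' hx hx' => simp only [map_add, LinearMap.add_apply, hx, hx', neg_add]
  | smul r x hx => simp only [map_smul, LinearMap.smul_apply, hx, smul_neg]
  | e j =>
  rw [bracketAux_e, bracketAux_e, add_comm j i]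
  module

theorem bracketAux_jacobi (x y z : WittAlgebra K) :
    bracketAux K x (bracketAux K y z) =
      bracketAux K (bracketAux K x y) z + bracketAux K y (bracketAux K x z) := by
  induction x using induction_e with
  | zero => simp
  | add x x' hx hx' => simp only [map_add, LinearMap.add_apply, hx, hx']; abel
  | smul r x hx => simp only [map_smul, LinearMap.smul_apply, hx, smul_add]
  | e i =>
  induction y using induction_e with
  | zero => simp
  | add x x' hx hx' => simp only [map_add, LinearMap.add_apply, hx, hx']; abel
  | smul r x hx => simp only [map_smul, LinearMap.smul_apply, hx, smul_add]
  | e j =>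
  induction z using induction_e with
  | zero => simp
  | add x x' hx hx' => simp only [map_add, hx, hx']; abel
  | smul r x hx => simp only [map_smul, hx, smul_add]
  | e k =>
  simp only [bracketAux_e, map_smul, LinearMap.smul_apply]
  rw [show j + (i + k) = i + (j + k) by ring, show i + j + k = i + (j + k) by ring]
  simp only [smul_smul, ← add_smul]
  congr 1
  push_cast
  ring

end

section

variable {K : Type*} [Field K] [CharZero K]

noncomputable instance : LieRing (WittAlgebra K) where
  bracket x y := bracketAux K x y
  add_lie x y z := by simp
  lie_add x y z := by simp
  lie_self x := by
    have h := bracketAux_skew x x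
    have h2 : (2 : K) • bracketAux K x x = 0 := by
      rw [two_smul]; nth_rewrite 1 [h]; simp
    exact (smul_eq_zero.mp h2).resolve_left two_ne_zero
  leibniz_lie := bracketAux_jacobi

noncomputable instance : LieAlgebra K (WittAlgebra K) where
  lie_smul r x y := map_smul (bracketAux K x) r y

theorem lie_def (x y : WittAlgebra K) : ⁅x, y⁆ = bracketAux K x y := rfl

theorem lie_e (i j : ℤ) : ⁅e K i, e K j⁆ = ((j : K) - (i : K)) • e K (i + j) :=
  bracketAux_e i j

end

end WittAlgebra

/-- The positive Witt algebra `W₊`: the Lie subalgebra of `W` spanned by `e n`, `n ≥ 1`. -/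
noncomputable def positiveWittAlgebra (K : Type*) [Field K] [CharZero K] :
    LieSubalgebra K (WittAlgebra K) where
  toSubmodule := Submodule.span K {x | ∃ n : ℤ, 1 ≤ n ∧ x = WittAlgebra.e K n}
  lie_mem' := by
    intro x y hx hy
    change ⁅x, y⁆ ∈ Submodule.span K _
    change x ∈ Submodule.span K _ at hx
    change y ∈ Submodule.span K _ at hy
    induction hx, hy using Submodule.span_induction₂ with
    | mem_mem x y hx hy =>
      obtain ⟨i, hi, rfl⟩ := hx
      obtain ⟨j, hj, rfl⟩ := hy
      rw [WittAlgebra.lie_e]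
      exact Submodule.smul_mem _ _ (Submodule.subset_span ⟨i + j, by lia, rfl⟩)
    | zero_left y hy => simp
    | zero_right x hx => simp
    | add_left x y z _ _ _ h1 h2 => rw [add_lie]; exact add_mem h1 h2
    | add_right x y z _ _ _ h1 h2 => rw [lie_add]; exact add_mem h1 h2
    | smul_left r x y _ _ h => rw [smul_lie]; exact Submodule.smul_mem _ r h
    | smul_right r x y _ _ h => rw [lie_smul]; exact Submodule.smul_mem _ r h

/-! ## The Virasoro algebra -/

/-- The Virasoro algebra over `K`: the `K`-vector space with basis `e n`, `n : ℤ`, together with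
`c`, where `c` is central and
`⁅e i, e j⁆ = (j - i) • e (i + j) + (if i + j = 0 then (i ^ 3 - i) / 12 else 0) • c`.
The pair `(x, a)` stands for `x + a • c`. -/
def VirasoroAlgebra (K : Type*) [Field K] : Type _ := WittAlgebra K × K

namespace VirasoroAlgebra

section

variable {K : Type*} [Field K]

noncomputable instance : AddCommGroup (VirasoroAlgebra K) :=
  inferInstanceAs (AddCommGroup (WittAlgebra K × K))

noncomputable instance : Module K (VirasoroAlgebra K) :=
  inferInstanceAs (Module K (WittAlgebra K × K))

variable (K) in
/-- The basis vector `e n` of the Virasoro algebra. -/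
noncomputable def e (n : ℤ) : VirasoroAlgebra K := (WittAlgebra.e K n, 0)

variable (K) in
/-- The central basis vector `c` of the Virasoro algebra. -/
noncomputable def c : VirasoroAlgebra K := (0, 1)

variable (K) in
/-- The coefficient of `c` in the bracket, as a bilinear form on the Witt algebra. -/
noncomputable def cocycle : WittAlgebra K →ₗ[K] WittAlgebra K →ₗ[K] K :=
  (WittAlgebra.basis K).constr K fun i => (WittAlgebra.basis K).constr K fun j =>
    if i + j = 0 then ((i : K) ^ 3 - (i : K)) / 12 else 0

theorem cocycle_e (i j : ℤ) :
    cocycle K (WittAlgebra.e K i) (WittAlgebra.e K j) =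
      if i + j = 0 then ((i : K) ^ 3 - (i : K)) / 12 else 0 := by
  simp only [cocycle, WittAlgebra.e, Module.Basis.constr_basis]

theorem cocycle_skew (x y : WittAlgebra K) : cocycle K x y = -cocycle K y x := by
  induction x using WittAlgebra.induction_e with
  | zero => simp
  | add x x' hx hx' => simp only [map_add, LinearMap.add_apply, hx, hx', neg_add]
  | smul r x hx => simp only [map_smul, LinearMap.smul_apply, hx, smul_neg]
  | e i =>
  induction y using WittAlgebra.induction_e with
  | zero => simp
  | add x x' hx hx' => simp only [map_add, LinearMap.add_apply, hx, hx', neg_add]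
  | smul r x hx => simp only [map_smul, LinearMap.smul_apply, hx, smul_neg]
  | e j =>
  rw [cocycle_e, cocycle_e, add_comm j i]
  split_ifs with h
  · obtain rfl : j = -i := by lia
    push_cast
    ring
  · simp

theorem cocycle_jacobi [CharZero K] (x y z : WittAlgebra K) :
    cocycle K x ⁅y, z⁆ = cocycle K ⁅x, y⁆ z + cocycle K y ⁅x, z⁆ := by
  simp only [WittAlgebra.lie_def]
  induction x using WittAlgebra.induction_e with
  | zero => simp
  | add x x' hx hx' => simp only [map_add, LinearMap.add_apply, hx, hx']; abel
  | smul r x hx => simp only [map_smul, LinearMap.smul_apply, hx, smul_add]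
  | e i =>
  induction y using WittAlgebra.induction_e with
  | zero => simp
  | add x x' hx hx' => simp only [map_add, LinearMap.add_apply, hx, hx']; abel
  | smul r x hx => simp only [map_smul, LinearMap.smul_apply, hx, smul_add]
  | e j =>
  induction z using WittAlgebra.induction_e with
  | zero => simp
  | add x x' hx hx' => simp only [map_add, hx, hx']; abel
  | smul r x hx => simp only [map_smul, hx, smul_add]
  | e k =>
  simp only [WittAlgebra.bracketAux_e, map_smul, LinearMap.smul_apply, cocycle_e, smul_eq_mul]
  rw [show j + (i + k) = i + (j + k) by ring, show i + j + k = i + (j + k) by ring]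
  split_ifs with h
  · obtain rfl : k = -i - j := by lia
    push_cast
    ring
  · simp

end

section

variable {K : Type*} [Field K] [CharZero K]

noncomputable instance : LieRing (VirasoroAlgebra K) where
  bracket x y := (⁅x.1, y.1⁆, cocycle K x.1 y.1)
  add_lie x y z := by
    refine Prod.ext ?_ ?_
    · exact add_lie x.1 y.1 z.1
    · exact LinearMap.map_add₂ (cocycle K) x.1 y.1 z.1
  lie_add x y z := by
    refine Prod.ext ?_ ?_
    · exact lie_add x.1 y.1 z.1
    · exact map_add (cocycle K x.1) y.1 z.1
  lie_self x := by
    refine Prod.ext ?_ ?_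
    · exact lie_self x.1
    · exact self_eq_neg.mp (cocycle_skew x.1 x.1)
  leibniz_lie x y z := by
    refine Prod.ext ?_ ?_
    · exact leibniz_lie x.1 y.1 z.1
    · exact cocycle_jacobi x.1 y.1 z.1

noncomputable instance : LieAlgebra K (VirasoroAlgebra K) where
  lie_smul r x y := by
    refine Prod.ext ?_ ?_
    · exact lie_smul r x.1 y.1
    · exact map_smul (cocycle K x.1) r y.1

theorem lie_def (x y : VirasoroAlgebra K) : ⁅x, y⁆ = (⁅x.1, y.1⁆, cocycle K x.1 y.1) := rfl

theorem lie_e (i j : ℤ) :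
    ⁅e K i, e K j⁆ = ((j : K) - (i : K)) • e K (i + j) +
      (if i + j = 0 then ((i : K) ^ 3 - (i : K)) / 12 else 0) • c K := by
  refine Prod.ext ?_ ?_
  · change ⁅WittAlgebra.e K i, WittAlgebra.e K j⁆ =
      ((j : K) - (i : K)) • WittAlgebra.e K (i + j) + _ • (0 : WittAlgebra K)
    rw [WittAlgebra.lie_e, smul_zero, add_zero]
  · change cocycle K (WittAlgebra.e K i) (WittAlgebra.e K j) =
      ((j : K) - (i : K)) • (0 : K) + _ • (1 : K)
    rw [cocycle_e, smul_zero, zero_add, smul_eq_mul, mul_one]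

theorem lie_c (x : VirasoroAlgebra K) : ⁅x, c K⁆ = 0 := by
  refine Prod.ext ?_ ?_
  · exact lie_zero x.1
  · exact map_zero (cocycle K x.1)

end

end VirasoroAlgebra

/-! The proof plays growth from above against growth from below. All three algebras are generated
over a noetherian commutative ring `Z` (`K`, or `K[c]` for the Virasoro algebra) by elements
satisfying the Witt relations up to scalars. Along a chain of completely prime ideals the
contractions to `Z` are prime and stabilise, so they may be taken equal to one prime `p`. If every
member lies in `pU`, all of them equal `pU`. Otherwise some `P` in the chain contains an `f` outside
`pU`.

Upper bound (`exists_wordSpan_le`): let `d` be the maximal length of the words of `f` whose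
coefficient is outside `p`. Commuting `f` with `d` elements `e n`, for large and widely spaced `n`,
stays in `P`. By the Leibniz rule the dominant terms are those in which each commutator hits a
different letter, and they form a multiple, by a scalar outside `p`, of a single word with `d` large
spaced letters. By choosing the `n`, every such word becomes reducible to lower words modulo `P`. A
word with many distinct letters contains such a word, or its mirror image under `e i ↦ -e (-i)`, so
only words with at most `D` distinct letters are needed. The number of those of weight at most `n`
is bounded by a polynomial of degree `2 * D` in `n`.

Lower bound (`exists_independentModulo`): if `P < Q` are completely prime and `a ∈ Q \ P`, then
powers of `a` times a family independent modulo `Q` are independent modulo `P`. Each strict step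
therefore raises the growth degree by one, and a chain that never stabilises forces growth of every
degree, contradicting the upper bound.

Only spanning by ordered words is used; linear independence in the Poincaré–Birkhoff–Witt theorem is
never needed. -/

/-! ## Algebras generated by elements satisfying the relations of the Witt algebra -/

/-- The elements `e i`, `i ∈ I`, of the `Z`-algebra `U` generate it and satisfy the relations of the
Witt algebra up to scalars, which occur only when `i + j = 0`. -/
structure IsWittSystem (Z : Type*) {U : Type*} [CommRing Z] [Ring U] [Algebra Z U]
    (I : Set ℤ) (e : ℤ → U) : Prop where
  add_mem : ∀ {i j}, i ∈ I → j ∈ I → i + j ∈ I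
  pos_mem : ∀ {i j}, i ∈ I → 0 < i → 0 < j → j ∈ I
  neg_mem : ∀ {i j}, i ∈ I → i < 0 → j < 0 → j ∈ I
  exists_lie : ∀ {i j}, i ∈ I → j ∈ I →
    ∃ z : Z, e i * e j - e j * e i = (j - i) • e (i + j) + algebraMap Z U z
  lie : ∀ {i j}, i ∈ I → j ∈ I → i + j ≠ 0 → e i * e j - e j * e i = (j - i) • e (i + j)
  adjoin_eq_top : Algebra.adjoin Z (e '' I) = ⊤

/-! ### Words in the generators, and reordering modulo smaller weight. -/

section Words

variable {Z U : Type*} [CommRing Z] [Ring U] [Algebra Z U] {I : Set ℤ} {e : ℤ → U}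

/-- The product of the elements `e i`, where `i` runs over a list. -/
def word (e : ℤ → U) (l : List ℤ) : U := (l.map e).prod

@[simp] theorem word_nil : word e [] = 1 := rfl

@[simp] theorem word_cons (i : ℤ) (l : List ℤ) : word e (i :: l) = e i * word e l := by
  simp [word]

theorem word_append (l l' : List ℤ) : word e (l ++ l') = word e l * word e l' := by
  simp [word]

variable (Z I e) in
/-- The `Z`-span of all words with letters in `I` satisfying `p`. -/
def wordSpan (p : List ℤ → Prop) : Submodule Z U :=
  Submodule.span Z {x | ∃ l, (∀ i ∈ l, i ∈ I) ∧ p l ∧ word e l = x}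

theorem word_mem_wordSpan {p : List ℤ → Prop} {l : List ℤ} (hl : ∀ i ∈ l, i ∈ I) (hp : p l) :
    word e l ∈ wordSpan Z I e p :=
  Submodule.subset_span ⟨l, hl, hp, rfl⟩

theorem wordSpan_le {p : List ℤ → Prop} {N : Submodule Z U}
    (h : ∀ l, (∀ i ∈ l, i ∈ I) → p l → word e l ∈ N) : wordSpan Z I e p ≤ N := by
  refine Submodule.span_le.mpr ?_
  rintro _ ⟨l, hl, hp, rfl⟩
  exact h l hl hp

theorem wordSpan_mono {p q : List ℤ → Prop} (h : ∀ l, p l → q l) :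
    wordSpan Z I e p ≤ wordSpan Z I e q :=
  wordSpan_le fun l hl hp => word_mem_wordSpan hl (h l hp)

theorem mul_mem_wordSpan {p q r : List ℤ → Prop} (h : ∀ l l', p l → q l' → r (l ++ l')) {x y : U}
    (hx : x ∈ wordSpan Z I e p) (hy : y ∈ wordSpan Z I e q) : x * y ∈ wordSpan Z I e r := by
  induction hx, hy using Submodule.span_induction₂ with
  | mem_mem x y hx hy =>
    obtain ⟨l, hl, hp, rfl⟩ := hx
    obtain ⟨l', hl', hq, rfl⟩ := hy
    rw [← word_append]
    refine word_mem_wordSpan (fun i hi => ?_) (h l l' hp hq)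
    exact (List.mem_append.mp hi).elim (hl i) (hl' i)
  | zero_left y hy => rw [zero_mul]; exact zero_mem _
  | zero_right x hx => rw [mul_zero]; exact zero_mem _
  | add_left x y z _ _ _ h1 h2 => rw [add_mul]; exact add_mem h1 h2
  | add_right x y z _ _ _ h1 h2 => rw [mul_add]; exact add_mem h1 h2
  | smul_left r x y _ _ h => rw [smul_mul_assoc]; exact Submodule.smul_mem _ r h
  | smul_right r x y _ _ h => rw [mul_smul_comm]; exact Submodule.smul_mem _ r h

theorem mem_wordSpan_true (h : IsWittSystem Z I e) (x : U) :
    x ∈ wordSpan Z I e fun _ => True := by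
  have hx : x ∈ Algebra.adjoin Z (e '' I) := h.adjoin_eq_top ▸ Algebra.mem_top
  induction hx using Algebra.adjoin_induction with
  | mem x hx =>
    obtain ⟨i, hi, rfl⟩ := hx
    have := word_mem_wordSpan (Z := Z) (I := I) (e := e) (p := fun _ => True) (l := [i])
      (by simpa using hi) trivial
    simpa using this
  | algebraMap z =>
    rw [Algebra.algebraMap_eq_smul_one]
    exact Submodule.smul_mem _ _ (word_mem_wordSpan (l := []) (by simp) trivial)
  | add x y _ _ hx hy => exact add_mem hx hy
  | mul x y _ _ hx hy => exact mul_mem_wordSpan (by simp) hx hy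

/-- The total weight of a list. -/
def listWeight (w : ℤ → ℕ) (l : List ℤ) : ℕ := (l.map w).sum

@[simp] theorem listWeight_nil (w : ℤ → ℕ) : listWeight w [] = 0 := rfl

@[simp] theorem listWeight_cons (w : ℤ → ℕ) (i : ℤ) (l : List ℤ) :
    listWeight w (i :: l) = w i + listWeight w l := by
  simp [listWeight]

@[simp] theorem listWeight_append (w : ℤ → ℕ) (l l' : List ℤ) :
    listWeight w (l ++ l') = listWeight w l + listWeight w l' := by
  simp [listWeight]

theorem listWeight_ofFn (w : ℤ → ℕ) {n : ℕ} (f : Fin n → ℤ) :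
    listWeight w (List.ofFn f) = ∑ i, w (f i) := by
  simp [listWeight, List.map_ofFn, List.sum_ofFn]

theorem List.Perm.listWeight_eq {w : ℤ → ℕ} {l l' : List ℤ} (h : l.Perm l') :
    listWeight w l = listWeight w l' :=
  (h.map w).sum_eq

/-- A weight on the integers is strictly subadditive if the commutator of two letters has smaller
weight than their product. -/
structure StrictSubadditive (w : ℤ → ℕ) : Prop where
  pos : ∀ i, 0 < w i
  add_lt : ∀ i j, w (i + j) < w i + w j

variable {w : ℤ → ℕ}

/-- Exchanging two adjacent letters produces a word in which `i` and `j` are merged into `i + j`,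
and a scalar multiple of the word with both deleted. Strict subadditivity and positivity of `w` make
both lighter, so letters commute up to lower weight. -/
theorem word_perm_sub_mem (h : IsWittSystem Z I e) (hw : StrictSubadditive w) {l l' : List ℤ}
    (hp : l.Perm l') (hl : ∀ i ∈ l, i ∈ I) :
    word e l - word e l' ∈ wordSpan Z I e fun u => listWeight w u < listWeight w l := by
  induction hp with
  | nil => simp
  | @cons i l l' hp ih =>
    rw [word_cons, word_cons, ← mul_sub, ← mul_one (e i), ← word_nil (e := e), ← word_cons]
    refine mul_mem_wordSpan (p := fun u => listWeight w u = w i) ?_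
      (word_mem_wordSpan (by simpa using hl i (by simp)) (by simp))
      (ih fun j hj => hl j (by simp [hj]))
    intro u v hu hv
    simp only [listWeight_append, listWeight_cons]
    omega
  | swap i j l =>
    have hi : i ∈ I := hl i (by simp)
    have hj : j ∈ I := hl j (by simp)
    have hl' : ∀ k ∈ l, k ∈ I := fun k hk => hl k (by simp [hk])
    obtain ⟨z, hz⟩ := h.exists_lie hj hi
    have key : word e (j :: i :: l) - word e (i :: j :: l) =
        (i - j) • word e ((j + i) :: l) + z • word e l := by
      simp only [word_cons, ← mul_assoc, ← sub_mul, hz, add_mul, smul_mul_assoc,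
        Algebra.smul_def z]
    rw [key]
    have h1 := hw.add_lt j i
    refine add_mem (zsmul_mem (word_mem_wordSpan ?_ ?_) _)
      (Submodule.smul_mem _ _ (word_mem_wordSpan hl' ?_))
    · intro k hk
      rcases List.mem_cons.mp hk with rfl | hk
      · exact h.add_mem hj hi
      · exact hl' k hk
    · simp only [listWeight_cons]; omega
    · have := hw.pos i
      simp only [listWeight_cons]; omega
  | @trans l₁ l₂ l₃ h12 h23 ih1 ih2 =>
    rw [← sub_add_sub_cancel _ (word e l₂)]
    refine add_mem (ih1 hl) ?_
    rw [h12.listWeight_eq]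
    exact ih2 fun i hi => hl i (h12.mem_iff.mpr hi)

/-- `U` is spanned by words, one for each multiset of letters. -/
theorem mem_span_word_toList (h : IsWittSystem Z I e) (x : U) :
    x ∈ Submodule.span Z ((fun m : Multiset ℤ => word e m.toList) '' {m | ∀ i ∈ m, i ∈ I}) := by
  set N := Submodule.span Z ((fun m : Multiset ℤ => word e m.toList) '' {m | ∀ i ∈ m, i ∈ I})
  have hw : StrictSubadditive fun i => i.natAbs + 1 := ⟨by simp, by intros; omega⟩
  have key : ∀ n, wordSpan Z I e (fun l => listWeight (fun i => i.natAbs + 1) l < n) ≤ N := by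
    intro n
    induction n with
    | zero => exact wordSpan_le (by simp)
    | succ n ih =>
      refine wordSpan_le fun l hl hn => ?_
      have hp : l.Perm (l : Multiset ℤ).toList :=
        Multiset.coe_eq_coe.mp (Multiset.coe_toList _).symm
      rw [← sub_add_cancel (word e l) (word e (l : Multiset ℤ).toList)]
      refine add_mem (ih (wordSpan_mono (fun u hu => ?_) (word_perm_sub_mem h hw hp hl))) ?_
      · omega
      · exact Submodule.subset_span ⟨l, by simpa using hl, rfl⟩
  refine (wordSpan_le fun l hl _ => key (_ + 1) (word_mem_wordSpan hl (Nat.lt_succ_self _)) :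
    wordSpan Z I e (fun _ => True) ≤ N) (mem_wordSpan_true h x)

/-! ### The symmetry `e i ↦ -e (-i)` -/

theorem IsWittSystem.mirror (h : IsWittSystem Z I e) :
    IsWittSystem Z {i | -i ∈ I} fun i => -e (-i) where
  add_mem {i j} hi hj := by
    simp only [Set.mem_ofPred_eq, neg_add] at *
    exact h.add_mem hi hj
  pos_mem {i j} hi h0 hj := h.neg_mem (i := -i) hi (by omega) (by omega)
  neg_mem {i j} hi h0 hj := h.pos_mem (i := -i) hi (by omega) (by omega)
  exists_lie {i j} hi hj := by
    obtain ⟨z, hz⟩ := h.exists_lie hi hj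
    refine ⟨z, ?_⟩
    rw [neg_mul_neg, neg_mul_neg, hz, neg_add, smul_neg, ← neg_smul]
    congr 2
    ring
  lie {i j} hi hj hij := by
    rw [neg_mul_neg, neg_mul_neg, h.lie hi hj (by omega), neg_add, smul_neg, ← neg_smul]
    congr 1
    ring
  adjoin_eq_top := by
    refine top_le_iff.mp (h.adjoin_eq_top.symm.le.trans (Algebra.adjoin_le ?_))
    rintro _ ⟨i, hi, rfl⟩
    have : -e (- -i) ∈ Algebra.adjoin Z ((fun i => -e (-i)) '' {i | -i ∈ I}) :=
      Algebra.subset_adjoin ⟨-i, by simpa using hi, rfl⟩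
    simpa using NegMemClass.neg_mem this

theorem word_mirror (l : List ℤ) :
    word (fun i => -e (-i)) l = (-1 : ℤ) ^ l.length • word e (l.map Neg.neg) := by
  induction l with
  | nil => simp
  | cons i l ih =>
    rw [word_cons, ih, List.length_cons, List.map_cons, word_cons, pow_succ', mul_smul_comm,
      mul_smul, neg_mul, smul_neg]
    simp

theorem wordSpan_mirror_le {p q : List ℤ → Prop} (hpq : ∀ l, p l → q (l.map Neg.neg)) :
    wordSpan Z {i | -i ∈ I} (fun i => -e (-i)) p ≤ wordSpan Z I e q := by
  refine wordSpan_le fun l hl hp => ?_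
  rw [word_mirror]
  refine zsmul_mem (word_mem_wordSpan ?_ (hpq l hp)) _
  simp only [List.mem_map]
  rintro _ ⟨i, hi, rfl⟩
  exact hl i hi

end Words

/-! ### Iterated commutators of a word. -/

section IteratedAd

variable {Z U : Type*} [CommRing Z] [Ring U] [Algebra Z U] {I : Set ℤ} {e : ℤ → U}

variable (Z) in
/-- The commutator with `x`, as a linear map. -/
def commutatorMap (x : U) : U →ₗ[Z] U := LinearMap.mulLeft Z x - LinearMap.mulRight Z x

theorem commutatorMap_apply (x y : U) : commutatorMap Z x y = x * y - y * x := rfl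

theorem commutatorMap_mul (x y z : U) :
    commutatorMap Z x (y * z) = commutatorMap Z x y * z + y * commutatorMap Z x z := by
  simp only [commutatorMap_apply]; noncomm_ring

variable (Z) in
/-- The composition of the commutator maps with `e i`, where `i` runs over a list. -/
def iterCommutator (e : ℤ → U) : List ℤ → (U →ₗ[Z] U)
  | [] => LinearMap.id
  | i :: l => commutatorMap Z (e i) ∘ₗ iterCommutator e l

theorem iterCommutator_mem {P : TwoSidedIdeal U} {x : U} (hx : x ∈ P) (l : List ℤ) :
    iterCommutator Z e l x ∈ P := by
  induction l with
  | nil => exact hx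
  | cons i l ih => exact P.sub_mem (P.mul_mem_left _ _ ih) (P.mul_mem_right _ _ ih)

/-- Leibniz rule. The positivity of `k j + n` excludes index zero, hence the scalar terms of the
bracket. -/
theorem commutatorMap_word (h : IsWittSystem Z I e) {n : ℤ} (hn : n ∈ I) {m : ℕ} (k : Fin m → ℤ)
    (hk : ∀ j, k j ∈ I) (hnk : ∀ j, 0 < k j + n) :
    commutatorMap Z (e n) (word e (List.ofFn k)) =
      ∑ j, (k j - n) • word e (List.ofFn (Function.update k j (k j + n))) := by
  induction m with
  | zero => simp [commutatorMap_apply]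
  | succ m ih =>
    have h0 : commutatorMap Z (e n) (e (k 0)) = (k 0 - n) • e (k 0 + n) := by
      rw [commutatorMap_apply, h.lie hn (hk 0) (by have := hnk 0; omega), add_comm n]
    rw [List.ofFn_succ, word_cons, commutatorMap_mul, h0,
      ih (fun j => k j.succ) (fun j => hk _) (fun j => hnk _), Fin.sum_univ_succ, Finset.mul_sum]
    congr 1
    · rw [List.ofFn_succ, word_cons, smul_mul_assoc]
      simp
    · refine Finset.sum_congr rfl fun j _ => ?_
      rw [List.ofFn_succ, word_cons, mul_smul_comm]
      congr 4
      ext i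
      by_cases hij : i = j
      · subst hij; simp
      · rw [Function.update_of_ne hij, Function.update_of_ne (by simpa using hij)]

/-- The tuple obtained from `k` by adding `n i` to its entry at `τ i`, for all `i`. -/
def shiftTuple {m r : ℕ} (k : Fin m → ℤ) (n : Fin r → ℤ) (τ : Fin r → Fin m) (j : Fin m) : ℤ :=
  k j + ∑ i, if τ i = j then n i else 0

theorem shiftTuple_of_forall_ne {m r : ℕ} {k : Fin m → ℤ} {n : Fin r → ℤ} {τ : Fin r → Fin m}
    {j : Fin m} (hj : ∀ i, τ i ≠ j) : shiftTuple k n τ j = k j := by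
  simp [shiftTuple, hj]

theorem shiftTuple_apply_of_injective {m r : ℕ} (k : Fin m → ℤ) (n : Fin r → ℤ)
    {τ : Fin r → Fin m} (hτ : Function.Injective τ) (i : Fin r) :
    shiftTuple k n τ (τ i) = k (τ i) + n i := by
  simp [shiftTuple, hτ.eq_iff]

theorem shiftTuple_mem (h : IsWittSystem Z I e) {m r : ℕ} {k : Fin m → ℤ} {n : Fin r → ℤ}
    (hk : ∀ j, k j ∈ I) (hn : ∀ i, n i ∈ I) (τ : Fin r → Fin m) (j : Fin m) :
    shiftTuple k n τ j ∈ I := by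
  classical
  rw [shiftTuple]
  induction (Finset.univ : Finset (Fin r)) using Finset.induction_on with
  | empty => simpa using hk j
  | insert i s hi ih =>
    rw [Finset.sum_insert hi]
    split_ifs with hij
    · rw [add_left_comm]; exact h.add_mem (hn i) ih
    · rwa [zero_add]

/-- Iterating the Leibniz rule, `τ i` records which letter absorbs `n i`. The coefficient is needed
only for injective `τ`, where each letter is hit at most once and the factors do not interact. -/
theorem iterCommutator_word (h : IsWittSystem Z I e) {m : ℕ} (k : Fin m → ℤ) (hk : ∀ j, k j ∈ I)
    {r : ℕ} (n : Fin r → ℤ) (hn : ∀ i, n i ∈ I) (hn0 : ∀ i, 0 < n i)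
    (hnk : ∀ i j, 0 < k j + n i) :
    ∃ c : (Fin r → Fin m) → ℤ,
      (∀ τ, Function.Injective τ → c τ = ∏ i, (k (τ i) - n i)) ∧
      iterCommutator Z e (List.ofFn n) (word e (List.ofFn k)) =
        ∑ τ, c τ • word e (List.ofFn (shiftTuple k n τ)) := by
  induction r with
  | zero =>
    refine ⟨fun _ => 1, by simp, ?_⟩
    have h0 : shiftTuple k n default = k := funext fun j => by simp [shiftTuple]
    simp [iterCommutator, h0]
  | succ r ih =>
    obtain ⟨c, hc, hsum⟩ := ih (fun i => n i.succ) (fun i => hn _) (fun i => hn0 _)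
      (fun i j => hnk _ _)
    -- The commutator with `e (n 0)` is outermost, so it acts on a letter already shifted by the
    -- others.
    refine ⟨fun σ => c (Fin.tail σ) *
      (shiftTuple k (fun i => n i.succ) (Fin.tail σ) (σ 0) - n 0), ?_, ?_⟩
    · intro σ hσ
      have h1 : Function.Injective (Fin.tail σ) := fun i j hij => by
        simpa using hσ hij
      have h2 : ∀ i, Fin.tail σ i ≠ σ 0 := fun i hi => by
        simpa using hσ hi
      dsimp only
      rw [hc _ h1, shiftTuple_of_forall_ne h2, Fin.prod_univ_succ, mul_comm]
      rfl
    · rw [List.ofFn_succ, iterCommutator, LinearMap.comp_apply, hsum, map_sum,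
        ← (Fin.consEquiv fun _ => Fin m).sum_comp, Fintype.sum_prod_type_right]
      refine Finset.sum_congr rfl fun τ _ => ?_
      have hpos : ∀ j, 0 < shiftTuple k (fun i => n i.succ) τ j + n 0 := fun j => by
        have h1 : 0 ≤ ∑ i : Fin r, if τ i = j then n i.succ else 0 :=
          Finset.sum_nonneg fun i _ => by
            split_ifs
            exacts [(hn0 _).le, le_rfl]
        have h2 := hnk 0 j
        rw [shiftTuple]
        omega
      rw [map_zsmul, commutatorMap_word h (hn 0) _ (shiftTuple_mem h hk (fun i => hn _) τ) hpos,
        Finset.smul_sum]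
      refine Finset.sum_congr rfl fun j _ => ?_
      rw [smul_smul]
      rw [show (Fin.consEquiv fun _ => Fin m) (j, τ) = Fin.cons j τ from rfl]
      simp only [Fin.tail_cons, Fin.cons_zero]
      congr 3
      ext j'
      by_cases hj : j' = j
      · subst hj
        simp only [Function.update_self, shiftTuple, Fin.sum_univ_succ, Fin.cons_zero,
          Fin.cons_succ, if_true]
        ring
      · simp [Function.update_of_ne hj, shiftTuple, Fin.sum_univ_succ, Ne.symm hj]

end IteratedAd

/-! ### The leading word of an iterated commutator. -/

section Reduction

variable {Z U : Type*} [CommRing Z] [Ring U] [Algebra Z U] {I : Set ℤ} {e : ℤ → U}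

/-- The weight of a letter: letters of absolute value more than `κ` cost `C` more. -/
def thresholdWeight (κ C : ℕ) (i : ℤ) : ℕ :=
  i.natAbs + C + 1 + if κ < i.natAbs then C else 0

/-- Two small letters may merge into a large one; the base cost `C + 1` of the letter that
disappears pays for the surcharge `C`. -/
theorem thresholdWeight_strictSubadditive (κ C : ℕ) :
    StrictSubadditive (thresholdWeight κ C) where
  pos i := by simp [thresholdWeight]
  add_lt i j := by simp only [thresholdWeight]; split_ifs <;> omega

theorem thresholdWeight_neg (κ C : ℕ) (i : ℤ) :
    thresholdWeight κ C (-i) = thresholdWeight κ C i := by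
  simp [thresholdWeight]

/-- The words that are smaller than `l`, by weight or, if the weights agree, by the sum of the
`2 ^ |i|`. -/
def IsLowerWord (κ C : ℕ) (l u : List ℤ) : Prop :=
  listWeight (thresholdWeight κ C) u < listWeight (thresholdWeight κ C) l ∨
    listWeight (thresholdWeight κ C) u = listWeight (thresholdWeight κ C) l ∧
      listWeight (fun i => 2 ^ i.natAbs) u < listWeight (fun i => 2 ^ i.natAbs) l

/-- If two commutators hit the same letter, at most `d - 1` letters become large. At least one
surcharge `C` is lost, which outweighs the total error `2 * d * κ` coming from the original letters.
-/
theorem listWeight_shiftTuple_lt {m d κ C : ℕ} {k : Fin m → ℤ} (hk : ∀ j, (k j).natAbs ≤ κ)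
    (hm : m ≤ d) (hC : 2 * d * κ < C) {n t : Fin d → ℤ} (hn : ∀ i, 0 < n i)
    (ht : ∀ i, (t i).natAbs ≤ κ) (ha : ∀ i, κ < n i + t i) {τ : Fin d → Fin m}
    (hτ : ¬ Function.Injective τ) :
    listWeight (thresholdWeight κ C) (List.ofFn (shiftTuple k n τ)) <
      listWeight (thresholdWeight κ C) (List.ofFn fun i => n i + t i) := by
  classical
  rw [listWeight_ofFn, listWeight_ofFn]
  have h1 : ∀ j, (thresholdWeight κ C (shiftTuple k n τ j) : ℤ) ≤
      (∑ i, if τ i = j then n i else 0) + (κ + C + 1) +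
        if j ∈ Finset.univ.image τ then (C : ℤ) else 0 := by
    intro j
    have hkj := hk j
    by_cases hj : j ∈ Finset.univ.image τ
    · have h0 : 0 ≤ ∑ i, if τ i = j then n i else 0 :=
        Finset.sum_nonneg fun i _ => by split_ifs; exacts [(hn i).le, le_rfl]
      rw [if_pos hj, thresholdWeight, shiftTuple]
      split_ifs <;> omega
    · have hj' : ∀ i, τ i ≠ j := by simpa using hj
      rw [shiftTuple_of_forall_ne hj', thresholdWeight, if_neg (by omega), if_neg hj]
      simp only [hj', if_false, Finset.sum_const_zero]
      omega
  have h2 : ∀ i, n i - κ + (2 * C + 1) ≤ (thresholdWeight κ C (n i + t i) : ℤ) := by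
    intro i
    have := ha i
    have := ht i
    rw [thresholdWeight, if_pos (by omega)]
    omega
  have h3 := Finset.sum_le_sum fun j (_ : j ∈ Finset.univ) => h1 j
  have h4 := Finset.sum_le_sum fun i (_ : i ∈ Finset.univ) => h2 i
  simp only [Finset.sum_add_distrib, Finset.sum_sub_distrib, Finset.sum_const, Finset.card_univ,
    Fintype.card_fin, nsmul_eq_mul, Finset.sum_ite_mem, Finset.univ_inter] at h3 h4
  rw [Finset.sum_comm] at h3
  simp only [Finset.sum_ite_eq, Finset.mem_univ, if_true] at h3
  have h5 : (Finset.univ.image τ).card < d := by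
    refine lt_of_le_of_ne (Finset.card_image_le.trans (by simp)) fun h => hτ ?_
    rw [← Set.injOn_univ, ← Finset.coe_univ]
    exact Finset.injOn_of_card_image_eq (by simpa using h)
  zify at h5 hC hm ⊢
  have h6 : ((Finset.univ.image τ).card : ℤ) * C ≤ (d - 1) * C :=
    mul_le_mul_of_nonneg_right (by omega) (by positivity)
  have h7 : (m : ℤ) * (κ + C + 1) ≤ d * (κ + C + 1) :=
    mul_le_mul_of_nonneg_right hm (by positivity)
  nlinarith

/-- At the first index `i` where `k` and `t` differ, the power of two at least doubles, while the
gaps make each later term at most `2 ^ (n i + k i) / 2 ^ d`. At most `d < 2 ^ d` such terms cannot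
undo the gain. -/
theorem sum_two_pow_lt_of_lex_lt {d κ : ℕ} {k t n : Fin d → ℤ} (hk : ∀ i, (k i).natAbs ≤ κ)
    (ht : ∀ i, (t i).natAbs ≤ κ) (hn : ∀ i, κ ≤ n i)
    (hgap : ∀ i j, i < j → n j + (2 * κ + d) ≤ n i) (hlt : toLex k < toLex t) :
    ∑ i, 2 ^ (n i + k i).natAbs < ∑ i, 2 ^ (n i + t i).natAbs := by
  obtain ⟨i, hi, hi'⟩ : ∃ i, (∀ j < i, k j = t j) ∧ k i < t i := hlt
  have h1 : ∀ j, 2 ^ d * 2 ^ (n j + k j).natAbs +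
      (if j = i then 2 ^ d * 2 ^ (n i + k i).natAbs else 0) ≤
        2 ^ d * 2 ^ (n j + t j).natAbs + 2 ^ (n i + k i).natAbs := by
    intro j
    have hkj := hk j
    have htj := ht j
    have hnj := hn j
    have hki := hk i
    have hni := hn i
    rcases lt_trichotomy j i with hj | rfl | hj
    · rw [hi j hj, if_neg hj.ne]
      simp
    · rw [if_pos rfl, ← mul_add, ← two_mul, ← pow_succ']
      refine le_add_right (Nat.mul_le_mul_left _ (Nat.pow_le_pow_right two_pos ?_))
      omega
    · have := hgap i j hj
      rw [if_neg hj.ne', ← pow_add, add_zero]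
      refine le_add_left (Nat.pow_le_pow_right two_pos ?_)
      omega
  have h2 := Finset.sum_le_sum fun j (_ : j ∈ Finset.univ) => h1 j
  simp only [Finset.sum_add_distrib, ← Finset.mul_sum, Finset.sum_ite_eq', Finset.mem_univ,
    if_true, Finset.sum_const, Finset.card_univ, Fintype.card_fin, smul_eq_mul] at h2
  have h3 : d * 2 ^ (n i + k i).natAbs < 2 ^ d * 2 ^ (n i + k i).natAbs :=
    Nat.mul_lt_mul_of_pos_right Nat.lt_two_pow_self (by positivity)
  exact Nat.lt_of_mul_lt_mul_left (a := 2 ^ d) (by omega)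

/-- Here `N` counts the injective `τ` that arrange the letters of the word as `t`; each contributes
the same leading word with the same coefficient. For other injective `τ`, the threshold weight
compares the sums of the arrangements and the powers of two break ties lexicographically, so the
maximality of `t` makes these terms lower. Terms with non-injective `τ` are lower by
`listWeight_shiftTuple_lt`. -/
theorem exists_iterCommutator_sub_mem (h : IsWittSystem Z I e) {m d κ C : ℕ} {k : Fin m → ℤ}
    (hkI : ∀ j, k j ∈ I) (hk : ∀ j, (k j).natAbs ≤ κ) (hm : m ≤ d) (hC : 2 * d * κ < C)
    {n t : Fin d → ℤ} (hnI : ∀ i, n i ∈ I) (ht : ∀ i, (t i).natAbs ≤ κ)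
    (hn : ∀ i, 2 * κ < n i) (hgap : ∀ i j, i < j → n j + (2 * κ + d) ≤ n i)
    (hmax : ∀ τ : Fin d → Fin m, Function.Injective τ → k ∘ τ = t ∨ ∑ i, k (τ i) < ∑ i, t i ∨
      ∑ i, k (τ i) = ∑ i, t i ∧ toLex (k ∘ τ) < toLex t) :
    ∃ N : ℕ, (N = 0 ↔ ¬ ∃ τ, Function.Injective τ ∧ k ∘ τ = t) ∧
      iterCommutator Z e (List.ofFn n) (word e (List.ofFn k)) -
        (N * ∏ i, (t i - n i)) • word e (List.ofFn fun i => n i + t i) ∈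
          wordSpan Z I e (IsLowerWord κ C (List.ofFn fun i => n i + t i)) := by
  classical
  have hpos : ∀ i, 0 < n i := fun i => by have := hn i; omega
  have hpos' : ∀ i j, 0 < k j + n i := fun i j => by have := hn i; have := hk j; omega
  obtain ⟨c, hc, hsum⟩ := iterCommutator_word h k hkI n hnI hpos hpos'
  refine ⟨∑ τ : Fin d → Fin m, if Function.Injective τ ∧ k ∘ τ = t then 1 else 0, ?_, ?_⟩
  · simp
  rw [hsum, Nat.cast_sum, Finset.sum_mul, Finset.sum_smul, ← Finset.sum_sub_distrib]
  refine sum_mem fun τ _ => ?_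
  have hshift : ∀ i ∈ List.ofFn (shiftTuple k n τ), i ∈ I := fun i hi => by
    obtain ⟨j, rfl⟩ := (List.mem_ofFn' _ _).mp hi
    exact shiftTuple_mem h hkI hnI τ j
  by_cases hτ : Function.Injective τ
  -- An injective `τ` forces `m = d` and is then a permutation of the positions.
  · obtain rfl : m = d := le_antisymm hm (by simpa using Fintype.card_le_of_injective τ hτ)
    have hperm : (List.ofFn (shiftTuple k n τ)).Perm (List.ofFn fun i => n i + k (τ i)) := by
      have h1 := Equiv.Perm.ofFn_comp_perm
        (Equiv.ofBijective τ (Finite.injective_iff_bijective.mp hτ)) (shiftTuple k n τ)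
      refine h1.symm.trans (.of_eq (congrArg _ (funext fun i => ?_)))
      rw [add_comm]
      exact shiftTuple_apply_of_injective k n hτ i
    have hweight : ∀ u : Fin m → ℤ, (∀ i, (u i).natAbs ≤ κ) →
        (listWeight (thresholdWeight κ C) (List.ofFn fun i => n i + u i) : ℤ) =
          ∑ i, u i + ∑ i, (n i + (2 * C + 1)) := by
      intro u hu
      rw [listWeight_ofFn, Nat.cast_sum, ← Finset.sum_add_distrib]
      refine Finset.sum_congr rfl fun i _ => ?_
      have h1 := hn i
      have h2 := hu i
      rw [thresholdWeight, if_pos (by omega)]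
      omega
    have hle : listWeight (thresholdWeight κ C) (List.ofFn fun i => n i + k (τ i)) ≤
        listWeight (thresholdWeight κ C) (List.ofFn fun i => n i + t i) := by
      zify
      rw [hweight t ht, hweight (fun i => k (τ i)) fun i => hk _]
      rcases hmax τ hτ with h1 | h1 | h1
      · rw [← h1]; rfl
      · gcongr
      · rw [h1.1]
    have hsub := word_perm_sub_mem h (thresholdWeight_strictSubadditive κ C) hperm hshift
    rw [hperm.listWeight_eq] at hsub
    replace hsub : _ ∈ wordSpan Z I e (IsLowerWord κ C (List.ofFn fun i => n i + t i)) :=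
      wordSpan_mono (fun u hu => Or.inl (hu.trans_le hle)) hsub
    rw [← sub_add_cancel (word e (List.ofFn (shiftTuple k n τ)))
      (word e (List.ofFn fun i => n i + k (τ i))), smul_add, add_sub_assoc]
    refine add_mem (zsmul_mem hsub _) ?_
    by_cases hkt : k ∘ τ = t
    · rw [if_pos ⟨hτ, hkt⟩, hc τ hτ]
      have h1 : ∀ i, k (τ i) = t i := fun i => congrFun hkt i
      simp [h1]
    · rw [if_neg (by tauto), Nat.cast_zero, zero_mul, zero_smul, sub_zero]
      refine zsmul_mem (word_mem_wordSpan (fun i hi => ?_) ?_) _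
      · obtain ⟨j, rfl⟩ := (List.mem_ofFn' _ _).mp hi
        exact h.add_mem (hnI _) (hkI _)
      · rcases (hmax τ hτ).resolve_left hkt with h1 | h1
        · left
          zify
          rw [hweight t ht, hweight (fun i => k (τ i)) fun i => hk _]
          gcongr
        · right
          constructor
          · zify
            rw [hweight t ht, hweight (fun i => k (τ i)) fun i => hk _, h1.1]
          · rw [listWeight_ofFn, listWeight_ofFn]
            exact sum_two_pow_lt_of_lex_lt (fun i => hk (τ i)) ht
              (fun i => by have := hn i; omega) hgap h1.2
  · rw [if_neg (by tauto), Nat.cast_zero, zero_mul, zero_smul, sub_zero]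
    refine zsmul_mem (word_mem_wordSpan hshift (Or.inl ?_)) _
    exact listWeight_shiftTuple_lt hk hm hC hpos ht
      (fun i => by have := hn i; have := ht i; omega) hτ

theorem ofFn_comp_perm_of_injective {m d : ℕ} (hm : m ≤ d) (k : Fin m → ℤ) {τ : Fin d → Fin m}
    (hτ : Function.Injective τ) : (List.ofFn (k ∘ τ)).Perm (List.ofFn k) := by
  obtain rfl : m = d := le_antisymm hm (by simpa using Fintype.card_le_of_injective τ hτ)
  exact Equiv.Perm.ofFn_comp_perm
    (Equiv.ofBijective τ (Finite.injective_iff_bijective.mp hτ)) k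

theorem exists_injective_of_ofFn_perm {m d : ℕ} {k : Fin m → ℤ} {t : Fin d → ℤ}
    (h : (List.ofFn t).Perm (List.ofFn k)) :
    ∃ τ : Fin d → Fin m, Function.Injective τ ∧ k ∘ τ = t := by
  have h1 : Relation.Comp (fun u v => u = List.map k v) List.Perm (List.ofFn t)
      (List.finRange m) := by
    rw [List.eq_map_comp_perm]
    exact h.trans (.of_eq List.ofFn_eq_map)
  obtain ⟨u, hu, hperm⟩ := h1
  have hlen : d = u.length := by simpa using congrArg List.length hu
  subst hlen
  refine ⟨u.get, List.nodup_iff_injective_get.mp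
    (hperm.nodup_iff.mpr (List.nodup_finRange m)), List.ofFn_injective ?_⟩
  rw [hu, ← List.map_ofFn, List.ofFn_get]

/-- The prescribed word `a` is made the leading word of an iterated commutator of an element of `P`.
Its coefficient comes from one multiset only, so nothing can cancel it. -/
theorem exists_smul_word_sub_mem (h : IsWittSystem Z I e)
    (hZ : ∀ m : ℤ, m ≠ 0 → IsUnit (m : Z)) {P : TwoSidedIdeal U} {p : Ideal Z} [p.IsPrime]
    {S : Finset (Multiset ℤ)} {z : Multiset ℤ → Z} {d κ C : ℕ} (hz : ∀ m ∈ S, z m ∉ p)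
    (hI : ∀ m ∈ S, ∀ i ∈ m, i ∈ I) (hκ : ∀ m ∈ S, ∀ i ∈ m, i.natAbs ≤ κ)
    (hd : ∀ m ∈ S, m.card ≤ d) (hd' : ∃ m ∈ S, m.card = d)
    (hP : ∑ m ∈ S, z m • word e m.toList ∈ P) (hC : 2 * d * κ < C) {a : Fin d → ℤ}
    (haI : ∀ i, a i ∈ I) (ha : ∀ i, 4 * κ + d + 1 ≤ a i)
    (hgap : ∀ i j, i < j → a j + (4 * κ + d + 1) ≤ a i) :
    ∃ s ∉ p, ∃ y ∈ P, s • word e (List.ofFn a) - y ∈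
      wordSpan Z I e (IsLowerWord κ C (List.ofFn a)) := by
  classical
  have hbound : ∀ t : Fin d → ℤ, (List.ofFn t : Multiset ℤ) ∈ S → ∀ i, (t i).natAbs ≤ κ :=
    fun t ht i => hκ _ ht _ (Multiset.mem_coe.mpr ((List.mem_ofFn' _ _).mpr ⟨i, rfl⟩))
  -- Among all orderings of the longest multisets in `S`, `t` is maximal for the sum and then
  -- lexicographically. This choice does not depend on `a`.
  obtain ⟨t, ht, hmax⟩ := Set.exists_max_image {t : Fin d → ℤ | (List.ofFn t : Multiset ℤ) ∈ S}
    (fun t => toLex (∑ i, t i, toLex t))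
    ((Set.finite_Icc (fun _ => -(κ : ℤ)) (fun _ => (κ : ℤ))).subset fun t ht => by
      constructor <;> intro i <;> have := hbound t ht i <;> dsimp only <;> omega)
    (by
      obtain ⟨m, hm, rfl⟩ := hd'
      refine ⟨fun i => m.toList.get (i.cast (by simp)), ?_⟩
      have h1 : List.ofFn (fun i : Fin m.card => m.toList.get (i.cast (by simp))) = m.toList :=
        (List.ofFn_congr (by simp) _).trans (List.ofFn_get m.toList)
      rw [Set.mem_ofPred_eq, h1, Multiset.coe_toList]
      exact hm)
  -- With these shifts the leading word is exactly `a`; the margins `4 * κ + d + 1` in `a` leave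
  -- those required of `n` after subtracting entries bounded by `κ`.
  set n : Fin d → ℤ := fun i => a i - t i with hn
  have hnt : (fun i => n i + t i) = a := funext fun i => by simp [hn]
  have key : ∀ m ∈ S, ∃ N : ℕ, (N = 0 ↔ m ≠ (List.ofFn t : Multiset ℤ)) ∧
      iterCommutator Z e (List.ofFn n) (word e m.toList) -
        (N * ∏ i, (t i - n i)) • word e (List.ofFn a) ∈
          wordSpan Z I e (IsLowerWord κ C (List.ofFn a)) := by
    intro m hm
    have hmap : ∀ τ : Fin d → Fin m.toList.length, Function.Injective τ →
        (List.ofFn (m.toList.get ∘ τ) : Multiset ℤ) = m := fun τ hτ => by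
      conv_rhs => rw [← Multiset.coe_toList m, ← List.ofFn_get m.toList]
      exact Multiset.coe_eq_coe.mpr
        (ofFn_comp_perm_of_injective (by simpa using hd m hm) _ hτ)
    obtain ⟨N, hN, hN'⟩ := exists_iterCommutator_sub_mem h (k := m.toList.get) (n := n) (t := t)
      (κ := κ) (C := C)
      (fun j => hI m hm _ (Multiset.mem_toList.mp (List.get_mem _ _)))
      (fun j => hκ m hm _ (Multiset.mem_toList.mp (List.get_mem _ _)))
      (by simpa using hd m hm) hC
      (fun i => h.pos_mem (haI i) (by have := ha i; omega)
        (by have := ha i; have := hbound t ht i; simp only [hn]; omega))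
      (hbound t ht)
      (fun i => by have := ha i; have := hbound t ht i; simp only [hn]; omega)
      (fun i j hij => by
        have := hgap i j hij
        have := hbound t ht i
        have := hbound t ht j
        simp only [hn]; omega)
      (fun τ hτ => by
        have h1 := hmax (m.toList.get ∘ τ) (by rw [Set.mem_ofPred_eq, hmap τ hτ]; exact hm)
        rcases Prod.Lex.le_iff.mp h1 with h2 | ⟨h2, h3⟩
        · exact Or.inr (Or.inl h2)
        · rcases h3.eq_or_lt with h4 | h4
          · exact Or.inl h4
          · exact Or.inr (Or.inr ⟨h2, h4⟩))
    rw [hnt, List.ofFn_get] at hN'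
    refine ⟨N, hN.trans (not_congr ⟨?_, ?_⟩), hN'⟩
    · rintro ⟨τ, hτ, rfl⟩
      exact (hmap τ hτ).symm
    · rintro rfl
      refine exists_injective_of_ofFn_perm ?_
      rw [List.ofFn_get, ← Multiset.coe_eq_coe, Multiset.coe_toList]
  choose! N hN hN' using key
  have hm0 := hN _ ht
  have hprod : (N (List.ofFn t) * ∏ i, (t i - n i) : ℤ) ≠ 0 := by
    refine mul_ne_zero ?_ (Finset.prod_ne_zero_iff.mpr fun i _ => ?_)
    · exact_mod_cast fun h0 => (hm0.mp h0) rfl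
    · have := ha i; have := hbound t ht i; simp only [hn]; omega
  -- This is the coefficient of the leading word: a nonzero integer, hence a unit of `Z`, times a
  -- coefficient outside `p`.
  refine ⟨((N (List.ofFn t) * ∏ i, (t i - n i) : ℤ) : Z) * z (List.ofFn t),
    ?_, iterCommutator Z e (List.ofFn n) (∑ m ∈ S, z m • word e m.toList),
    iterCommutator_mem hP _, ?_⟩
  · rw [Ideal.unit_mul_mem_iff_mem _ (hZ _ hprod)]
    exact hz _ ht
  · rw [← neg_sub]
    refine NegMemClass.neg_mem ?_
    have hs : (((N (List.ofFn t) * ∏ i, (t i - n i) : ℤ) : Z) *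
        z (List.ofFn t)) • word e (List.ofFn a) =
        ∑ m ∈ S, z m • ((N m * ∏ i, (t i - n i) : ℤ) • word e (List.ofFn a)) := by
      rw [Finset.sum_eq_single_of_mem _ ht fun m hm hne => by
        rw [(hN m hm).mpr hne, Nat.cast_zero, zero_mul, zero_smul, smul_zero]]
      rw [mul_comm, mul_smul, Int.cast_smul_eq_zsmul]
    rw [hs, map_sum, ← Finset.sum_sub_distrib]
    refine sum_mem fun m hm => ?_
    rw [map_smul, ← smul_sub]
    exact Submodule.smul_mem _ _ (hN' m hm)

end Reduction

/-! ### Rank over `Z ⧸ p`, and independence modulo an ideal. -/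

section Growth

variable {Z U : Type*} [CommRing Z] [Ring U] [Algebra Z U] {I : Set ℤ} {e : ℤ → U}

variable (Z) in
/-- A two-sided ideal as a `Z`-submodule. -/
def TwoSidedIdeal.toSubmodule (P : TwoSidedIdeal U) : Submodule Z U where
  carrier := {x | x ∈ P}
  add_mem' := P.add_mem
  zero_mem' := P.zero_mem
  smul_mem' z x hx := by
    rw [Algebra.smul_def]
    exact P.mul_mem_left _ _ hx

/-- The elements that are multiplied into `N` by an element outside the prime ideal `p`. -/
def primeSaturation (p : Ideal Z) [hp : p.IsPrime] (N : Submodule Z U) :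
    Submodule Z U where
  carrier := {x | ∃ s ∉ p, s • x ∈ N}
  add_mem' := by
    rintro x y ⟨s, hs, hx⟩ ⟨t, ht, hy⟩
    refine ⟨s * t, fun h => (hp.mem_or_mem h).elim hs ht, ?_⟩
    rw [smul_add, mul_smul s t y, mul_comm, mul_smul]
    exact add_mem (N.smul_mem _ hx) (N.smul_mem _ hy)
  zero_mem' := ⟨1, fun h => hp.ne_top ((Ideal.eq_top_iff_one p).mpr h), by simp⟩
  smul_mem' := by
    rintro z x ⟨s, hs, hx⟩
    exact ⟨s, hs, by rw [smul_comm]; exact N.smul_mem _ hx⟩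

section

variable {p : Ideal Z} [hp : p.IsPrime]

theorem le_primeSaturation (N : Submodule Z U) : N ≤ primeSaturation p N :=
  fun x hx => ⟨1, fun h => hp.ne_top ((Ideal.eq_top_iff_one p).mpr h), by simpa using hx⟩

theorem mem_primeSaturation_of_smul_mem {N : Submodule Z U} {s : Z} (hs : s ∉ p) {x : U}
    (hx : s • x ∈ primeSaturation p N) : x ∈ primeSaturation p N := by
  obtain ⟨t, ht, h⟩ := hx
  exact ⟨t * s, fun h => (hp.mem_or_mem h).elim ht hs, by rwa [mul_smul]⟩

end

/-- A family of elements of `U` is independent modulo `P` if a `Z`-linear combination of it lies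
in `P` only if all the coefficients lie in `p`. -/
def IndependentModulo (p : Ideal Z) (P : TwoSidedIdeal U) {ι : Type*} [Fintype ι] (b : ι → U) :
    Prop :=
  ∀ z : ι → Z, ∑ i, z i • b i ∈ P → ∀ i, z i ∈ p

/-- If there were more `b i` than `g j`, the coefficient vectors over the domain `Z ⧸ p` would be
linearly dependent. Lifting a dependence gives a relation among the `b i` modulo `P`; the
denominators `s i` lie outside the prime `p` and can be cancelled. -/
theorem IndependentModulo.card_le {p : Ideal Z} [hp : p.IsPrime] {P : TwoSidedIdeal U}
    {ι β : Type*} [Fintype ι] [Fintype β] {b : ι → U} (hb : IndependentModulo p P b) (g : β → U)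
    (hpP : ∀ z ∈ p, algebraMap Z U z ∈ P)
    (hg : ∀ i, b i ∈ primeSaturation p (P.toSubmodule Z ⊔ Submodule.span Z (Set.range g))) :
    Fintype.card ι ≤ Fintype.card β := by
  by_contra! hlt
  choose s hs hsb using hg
  have h1 : ∀ i, ∃ c : β → Z, s i • b i - ∑ j, c j • g j ∈ P := fun i => by
    obtain ⟨y, hy, x, hx, hxy⟩ := Submodule.mem_sup.mp (hsb i)
    obtain ⟨c, rfl⟩ := (Submodule.mem_span_range_iff_exists_fun Z).mp hx
    exact ⟨c, by rw [← hxy, add_sub_cancel_right]; exact hy⟩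
  choose c hc using h1
  have h2 : ¬ LinearIndependent (Z ⧸ p) fun i j => Ideal.Quotient.mk p (c i j) := fun h => by
    have := h.fintype_card_le_finrank
    rw [Module.finrank_fintype_fun_eq_card] at this
    omega
  obtain ⟨v, hv, i₀, hi₀⟩ := Fintype.not_linearIndependent_iff.mp h2
  choose u hu using fun i => Ideal.Quotient.mk_surjective (v i)
  have h3 : ∀ j, ∑ i, u i * c i j ∈ p := fun j => by
    rw [← Ideal.Quotient.eq_zero_iff_mem]
    simpa [hu] using congrFun hv j
  have h4 : ∑ i, (u i * s i) • b i ∈ P := by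
    have h5 : ∑ i, (u i * s i) • b i =
        ∑ i, u i • (s i • b i - ∑ j, c i j • g j) + ∑ j, (∑ i, u i * c i j) • g j := by
      simp only [smul_sub, Finset.sum_sub_distrib, mul_smul, Finset.smul_sum, Finset.sum_smul]
      rw [Finset.sum_comm (γ := β), sub_add_cancel]
    rw [h5]
    refine P.add_mem ?_ ?_
    · refine (P.toSubmodule Z).sum_mem fun i _ => Submodule.smul_mem _ _ ?_
      exact hc i
    · refine (P.toSubmodule Z).sum_mem fun j _ => ?_
      rw [Algebra.smul_def]
      exact P.mul_mem_right _ _ (hpP _ (h3 j))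
  refine hi₀ ?_
  rw [← hu, Ideal.Quotient.eq_zero_iff_mem]
  exact (hp.mem_or_mem (hb _ h4 i₀)).resolve_right (hs i₀)

/-- Read a relation as a polynomial in `a`. Modulo `Q` only its constant part survives, so those
coefficients lie in `p`. That part then lies in `P` and is removed, and `a` is cancelled because `P`
is completely prime and `a ∉ P`. -/
theorem IndependentModulo.pow_mul {p : Ideal Z} {P Q : TwoSidedIdeal U} (hP : IsCompletelyPrime P)
    (hPQ : P ≤ Q) (hpP : ∀ z ∈ p, algebraMap Z U z ∈ P) {a : U} (haQ : a ∈ Q) (haP : a ∉ P)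
    {ι : Type*} [Fintype ι] {b : ι → U} (hb : IndependentModulo p Q b) (x : ℕ) :
    IndependentModulo p P fun q : Fin x × ι => a ^ (q.1 : ℕ) * b q.2 := by
  have key : ∀ (x : ℕ) (y : Fin x → ι → Z), ∑ i : Fin x, a ^ (i : ℕ) * ∑ j, y i j • b j ∈ P →
      ∀ i j, y i j ∈ p := by
    intro x
    induction x with
    | zero => exact fun y _ i => i.elim0
    | succ x ih =>
      intro y hy
      have hsplit : ∑ i : Fin (x + 1), a ^ (i : ℕ) * ∑ j, y i j • b j = ∑ j, y 0 j • b j +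
          a * ∑ i : Fin x, a ^ (i : ℕ) * ∑ j, y i.succ j • b j := by
        rw [Fin.sum_univ_succ]
        simp only [Fin.val_zero, pow_zero, one_mul, Fin.val_succ, pow_succ', mul_assoc,
          Finset.mul_sum]
      rw [hsplit] at hy
      have h0 : ∀ j, y 0 j ∈ p := by
        refine hb (y 0) ?_
        have := Q.sub_mem (hPQ hy)
          (Q.mul_mem_right _ (∑ i : Fin x, a ^ (i : ℕ) * ∑ j, y i.succ j • b j) haQ)
        rwa [add_sub_cancel_right] at this
      have h1 : ∑ j, y 0 j • b j ∈ P.toSubmodule Z := sum_mem fun j _ => by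
        rw [Algebra.smul_def]
        exact P.mul_mem_right _ _ (hpP _ (h0 j))
      have h2 := P.sub_mem hy h1
      rw [add_sub_cancel_left] at h2
      have h3 := ih _ ((hP.mem_or_mem h2).resolve_left haP)
      exact Fin.cases h0 h3
  intro z hz q
  refine key x (fun i j => z (i, j)) ?_ q.1 q.2
  simpa only [Fintype.sum_prod_type, Finset.mul_sum, mul_smul_comm] using hz

/-- Greedy choice: take the maximum `x` and discard the at most `L` elements of `A` in `(x - L, x]`.
-/
theorem exists_separated {A : Finset ℤ} {d L : ℕ} (h : d * L < A.card) :
    ∃ a : Fin d → ℤ, (∀ i, a i ∈ A) ∧ ∀ i j, i < j → a j + L ≤ a i := by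
  induction d generalizing A with
  | zero => exact ⟨Fin.elim0, fun i => i.elim0, fun i => i.elim0⟩
  | succ d ih =>
    have hne : A.Nonempty := Finset.card_pos.mp (by omega)
    set x := A.max' hne
    have hsub : A ⊆ A.filter (fun y => y + L ≤ x) ∪ Finset.Ioc (x - L) x := fun y hy => by
      have := A.le_max' y hy
      simp only [Finset.mem_union, Finset.mem_filter, Finset.mem_Ioc, hy, true_and]
      omega
    have hcard := (Finset.card_le_card hsub).trans (Finset.card_union_le _ _)
    rw [Int.card_Ioc, add_mul] at *
    obtain ⟨a, haA, ha⟩ := ih (A := A.filter fun y => y + L ≤ x) (by omega)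
    refine ⟨Fin.cons x a, Fin.cases (A.max'_mem hne) fun i => (Finset.mem_filter.mp (haA i)).1,
      ?_⟩
    intro i j hij
    induction j using Fin.cases with
    | zero => exact absurd hij (Fin.not_lt_zero _)
    | succ j =>
      induction i using Fin.cases with
      | zero => exact (Finset.mem_filter.mp (haA j)).2
      | succ i => exact ha i j (Fin.succ_lt_succ_iff.mp hij)

end Growth

/-! ### Reducible words and the polynomial upper bound. -/

section GoodWords

variable {Z U : Type*} [CommRing Z] [Ring U] [Algebra Z U] {I : Set ℤ} {e : ℤ → U}
  {p : Ideal Z} {P : TwoSidedIdeal U}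

/-- Up to a factor outside `p`, the word `l` is congruent modulo `P` to a combination of lower
words. -/
def IsReducibleWord (p : Ideal Z) (P : TwoSidedIdeal U) (I : Set ℤ) (e : ℤ → U) (κ C : ℕ)
    (l : List ℤ) : Prop :=
  ∃ s ∉ p, ∃ y ∈ P, s • word e l - y ∈ wordSpan Z I e (IsLowerWord κ C l)

/-- Terms of `f` with coefficient in `p` already lie in `P` and can be dropped. Since `f ∉ p • ⊤`,
some term remains, and `exists_smul_word_sub_mem` applies to the rest. -/
theorem exists_isReducibleWord (h : IsWittSystem Z I e) (hZ : ∀ m : ℤ, m ≠ 0 → IsUnit (m : Z))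
    [p.IsPrime] (hpP : ∀ z ∈ p, algebraMap Z U z ∈ P) {f : U} (hf : f ∈ P)
    (hf' : f ∉ p • (⊤ : Submodule Z U)) :
    ∃ d κ₀ : ℕ, ∀ κ, κ₀ ≤ κ → ∀ C, 2 * d * κ < C → ∀ a : Fin d → ℤ, (∀ i, a i ∈ I) →
      (∀ i, 4 * κ + d + 1 ≤ a i) → (∀ i j, i < j → a j + (4 * κ + d + 1) ≤ a i) →
        IsReducibleWord p P I e κ C (List.ofFn a) := by
  classical
  obtain ⟨c, hcI, hc⟩ :=
    (Finsupp.mem_span_image_iff_linearCombination Z).mp (mem_span_word_toList h f)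
  rw [Finsupp.linearCombination_apply, Finsupp.sum] at hc
  have hsplit := Finset.sum_filter_add_sum_filter_not c.support (fun m => c m ∈ p)
    fun m => c m • word e m.toList
  rw [hc] at hsplit
  have hmem : ∑ m ∈ c.support with c m ∈ p, c m • word e m.toList ∈ p • (⊤ : Submodule Z U) :=
    sum_mem fun m hm => Submodule.smul_mem_smul (Finset.mem_filter.mp hm).2 trivial
  have hmem' : ∑ m ∈ c.support with c m ∈ p, c m • word e m.toList ∈ P.toSubmodule Z :=
    sum_mem fun m hm => by
      rw [Algebra.smul_def]
      exact P.mul_mem_right _ _ (hpP _ (Finset.mem_filter.mp hm).2)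
  set S := c.support.filter fun m => c m ∉ p
  have hne : S.Nonempty := by
    by_contra hempty
    rw [Finset.not_nonempty_iff_eq_empty] at hempty
    rw [hempty, Finset.sum_empty, add_zero] at hsplit
    exact hf' (hsplit ▸ hmem)
  refine ⟨S.sup Multiset.card, S.sup fun m => m.toFinset.sup Int.natAbs, ?_⟩
  intro κ hκ C hC a haI ha hgap
  refine exists_smul_word_sub_mem h hZ (S := S) (z := c) (fun m hm => (Finset.mem_filter.mp hm).2)
    (fun m hm => hcI (Finset.mem_filter.mp hm).1) (fun m hm i hi => ?_)
    (fun m hm => Finset.le_sup (f := Multiset.card) hm) ?_ ?_ hC haI ha hgap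
  · exact (Finset.le_sup (Multiset.mem_toFinset.mpr hi)).trans
      ((Finset.le_sup (f := fun m : Multiset ℤ => m.toFinset.sup Int.natAbs) hm).trans hκ)
  · obtain ⟨m, hm, hm'⟩ := Finset.exists_mem_eq_sup S hne Multiset.card
    exact ⟨m, hm, hm'.symm⟩
  · have := P.sub_mem hf hmem'
    rwa [← hsplit, add_sub_cancel_left] at this

/-- Move the letters of `a` to the front at the cost of lighter words. Both weights are additive
under concatenation, so words lower than `a` stay lower after appending the remaining letters. -/
theorem IsReducibleWord.of_subperm (h : IsWittSystem Z I e) {κ C : ℕ} {a l : List ℤ}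
    (ha : IsReducibleWord p P I e κ C a) (hal : a.Subperm l) (hl : ∀ i ∈ l, i ∈ I) :
    IsReducibleWord p P I e κ C l := by
  obtain ⟨s, hs, y, hy, hsy⟩ := ha
  obtain ⟨a', haa', hsub⟩ := hal
  obtain ⟨r, hr'⟩ := hsub.exists_perm_append
  have hr : l.Perm (a ++ r) := hr'.trans (haa'.append_right r)
  refine ⟨s, hs, y * word e r, P.mul_mem_right _ _ hy, ?_⟩
  have hsplit : s • word e l - y * word e r =
      s • (word e l - word e (a ++ r)) + (s • word e a - y) * word e r := by
    rw [word_append, smul_sub, sub_mul, smul_mul_assoc]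
    abel
  rw [hsplit]
  refine add_mem (Submodule.smul_mem _ _ (wordSpan_mono (fun u hu => Or.inl hu)
    (word_perm_sub_mem h (thresholdWeight_strictSubadditive κ C) hr hl))) ?_
  refine mul_mem_wordSpan (q := fun u => u = r) ?_ hsy
    (word_mem_wordSpan (fun i hi => hl i (hr.mem_iff.mpr (by simp [hi]))) rfl)
  rintro u _ hu rfl
  rw [IsLowerWord] at *
  rw [hr.listWeight_eq, hr.listWeight_eq]
  simp only [listWeight_append]
  omega

theorem listWeight_map_neg {w : ℤ → ℕ} (hw : ∀ i, w (-i) = w i) (l : List ℤ) :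
    listWeight w (l.map Neg.neg) = listWeight w l := by
  induction l with
  | nil => rfl
  | cons i l ih => simp [ih, hw]

theorem IsReducibleWord.of_mirror {κ C : ℕ} {a : List ℤ}
    (ha : IsReducibleWord p P {i | -i ∈ I} (fun i => -e (-i)) κ C a) :
    IsReducibleWord p P I e κ C (a.map Neg.neg) := by
  obtain ⟨s, hs, y, hy, hsy⟩ := ha
  refine ⟨s, hs, (-1 : ℤ) ^ a.length • y, P.zsmul_mem _ hy, ?_⟩
  have hle := wordSpan_mirror_le (Z := Z) (e := e) (I := I) (p := IsLowerWord κ C a)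
    (q := IsLowerWord κ C (a.map Neg.neg)) (fun u hu => by
      simpa only [IsLowerWord, listWeight_map_neg (thresholdWeight_neg κ C),
        listWeight_map_neg (w := fun i => 2 ^ i.natAbs) (by simp)] using hu) hsy
  rw [word_mirror] at hle
  have := zsmul_mem hle ((-1 : ℤ) ^ a.length)
  rwa [smul_sub, smul_comm s, smul_smul, ← mul_pow, neg_one_mul, neg_neg, one_pow, one_smul]
    at this

/-- Many distinct letters force many large positive or many large negative ones. The negative case
is the positive one for the mirrored system, whose ideal `P` is the same. -/
theorem exists_isReducibleWord_of_card (h : IsWittSystem Z I e)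
    (hZ : ∀ m : ℤ, m ≠ 0 → IsUnit (m : Z)) [p.IsPrime]
    (hpP : ∀ z ∈ p, algebraMap Z U z ∈ P) {f : U} (hf : f ∈ P)
    (hf' : f ∉ p • (⊤ : Submodule Z U)) :
    ∃ D κ C : ℕ, ∀ l : List ℤ, (∀ i ∈ l, i ∈ I) → D < l.toFinset.card →
      IsReducibleWord p P I e κ C l := by
  obtain ⟨d₁, κ₁, h₁⟩ := exists_isReducibleWord h hZ hpP hf hf'
  obtain ⟨d₂, κ₂, h₂⟩ := exists_isReducibleWord h.mirror hZ hpP hf hf'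
  set κ := max κ₁ κ₂
  set C := 2 * max d₁ d₂ * κ + 1
  set L := 4 * κ + max d₁ d₂ + 1
  have hC₁ : 2 * d₁ * κ < C := Nat.lt_succ_of_le (by gcongr; exact le_max_left _ _)
  have hC₂ : 2 * d₂ * κ < C := Nat.lt_succ_of_le (by gcongr; exact le_max_right _ _)
  have hnodup : ∀ {d : ℕ} {a : Fin d → ℤ}, (∀ i j, i < j → a j + L ≤ a i) →
      Function.Injective a := fun {d a} ha =>
    StrictAnti.injective fun i j hij => by have := ha i j hij; omega
  -- The interval `[-L, L]` holds `2 * L + 1` letters; beyond this bound, more than `d₁ * L` letters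
  -- are at least `L` or more than `d₂ * L` are at most `-L`, as `exists_separated` requires.
  refine ⟨2 * L + 1 + d₁ * L + d₂ * L, κ, C, fun l hl hcard => ?_⟩
  have hsub : l.toFinset ⊆ Finset.Icc (-(L : ℤ)) L ∪ l.toFinset.filter (fun i => (L : ℤ) ≤ i) ∪
      l.toFinset.filter (fun i => i ≤ -(L : ℤ)) := fun i hi => by
    simp only [Finset.mem_union, Finset.mem_Icc, Finset.mem_filter, hi, true_and]
    omega
  have hle := (Finset.card_le_card hsub).trans ((Finset.card_union_le _ _).trans
    (Nat.add_le_add_right (Finset.card_union_le _ _) _))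
  rw [Int.card_Icc] at hle
  rcases (by omega : d₁ * L < (l.toFinset.filter fun i => (L : ℤ) ≤ i).card ∨
    d₂ * L < (l.toFinset.filter fun i => i ≤ -(L : ℤ)).card) with hlt | hlt
  · obtain ⟨a, haA, ha⟩ := exists_separated hlt
    simp only [Finset.mem_filter, List.mem_toFinset] at haA
    refine (h₁ κ (le_max_left _ _) C hC₁ a (fun i => hl _ (haA i).1)
      (fun i => by have := (haA i).2; omega)
      (fun i j hij => by have := ha i j hij; omega)).of_subperm h ?_ hl
    refine (List.nodup_ofFn.mpr (hnodup ha)).subperm fun i hi => ?_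
    obtain ⟨j, rfl⟩ := (List.mem_ofFn' _ _).mp hi
    exact (haA j).1
  · rw [← Finset.card_image_of_injective _ (neg_injective (G := ℤ))] at hlt
    obtain ⟨a, haA, ha⟩ := exists_separated hlt
    have haA' : ∀ i, -a i ∈ l ∧ (L : ℤ) ≤ a i := fun i => by
      obtain ⟨j, hj, hji⟩ := Finset.mem_image.mp (haA i)
      simp only [Finset.mem_filter, List.mem_toFinset] at hj
      rw [← hji, neg_neg]
      exact ⟨hj.1, by omega⟩
    refine (h₂ κ (le_max_right _ _) C hC₂ a (fun i => hl _ (haA' i).1)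
      (fun i => by have := (haA' i).2; omega)
      (fun i j hij => by have := ha i j hij; omega)).of_mirror.of_subperm h ?_ hl
    refine ((List.nodup_ofFn.mpr (hnodup ha)).map neg_injective).subperm fun i hi => ?_
    obtain ⟨j, hj, rfl⟩ := List.mem_map.mp hi
    obtain ⟨k, rfl⟩ := (List.mem_ofFn' _ _).mp hj
    exact (haA' k).1

/-- The list in which the first component of each pair in `b` is repeated as often as the second
component says. -/
def expandList {D : ℕ} (b : Fin D → ℤ × ℕ) : List ℤ :=
  (List.ofFn b).flatMap fun q => List.replicate q.2 q.1

theorem exists_perm_expandList {D : ℕ} {l : List ℤ} (hl : l.toFinset.card ≤ D) {n : ℕ}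
    (hn : ∀ i ∈ l, i.natAbs ≤ n) (hlen : l.length ≤ n) :
    ∃ b : Fin D → ℤ × ℕ, (∀ i, (b i).1 ∈ Finset.Icc (-(n : ℤ)) n ∧ (b i).2 ∈ Finset.range (n + 1)) ∧
      l.Perm (expandList b) := by
  induction D generalizing l with
  | zero =>
    obtain rfl : l = [] := by simpa using hl
    exact ⟨Fin.elim0, fun i => i.elim0, by simp [expandList]⟩
  | succ D ih =>
    cases l with
    -- Unused slots are filled with the letter `0` repeated zero times.
    | nil => exact ⟨fun _ => (0, 0), by simp, by simp [expandList]⟩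
    | cons x l =>
      set l₀ := x :: l with hl₀
      have hsub : (l₀.filter (· ≠ x)).toFinset ⊆ l₀.toFinset.erase x := fun i hi => by
        simp at hi ⊢
        tauto
      have hcard := Finset.card_le_card hsub
      rw [Finset.card_erase_of_mem (by simp [hl₀])] at hcard
      obtain ⟨b, hb, hperm⟩ := ih (l := l₀.filter (· ≠ x)) (by omega)
        (fun i hi => hn i (List.mem_of_mem_filter hi)) ((List.length_filter_le _ _).trans hlen)
      refine ⟨Fin.cons (x, l₀.count x) b, Fin.cases ?_ hb, ?_⟩
      · have h1 := List.filter_append_perm (· = x) l₀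
        rw [List.filter_eq] at h1
        have h2 : expandList (Fin.cons (x, l₀.count x) b) =
            List.replicate (l₀.count x) x ++ expandList b := by
          rw [expandList, List.ofFn_cons, List.flatMap_cons]; rfl
        rw [h2]
        refine h1.symm.trans (List.Perm.append_left _ ?_)
        simpa using hperm
      · have h1 := hn x (by simp [hl₀])
        have h2 := (List.count_le_length (a := x) (l := l₀)).trans hlen
        rw [Fin.cons_zero, Finset.mem_Icc, Finset.mem_range]
        omega

theorem isLowerWord_wellFounded (κ C : ℕ) :
    WellFounded fun u l : List ℤ => IsLowerWord κ C l u := by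
  refine Subrelation.wf (r := InvImage (Prod.Lex (· < ·) (· < ·)) fun l : List ℤ =>
    (listWeight (thresholdWeight κ C) l, listWeight (fun i => 2 ^ i.natAbs) l)) ?_
    (InvImage.wf _ (WellFounded.prod_lex wellFounded_lt wellFounded_lt))
  intro u l hul
  exact Prod.lex_def.mpr hul

/-- The words of bounded weight generate a module whose rank modulo `P` grows polynomially. -/
theorem exists_wordSpan_le (h : IsWittSystem Z I e)
    (hZ : ∀ m : ℤ, m ≠ 0 → IsUnit (m : Z)) [p.IsPrime]
    (hpP : ∀ z ∈ p, algebraMap Z U z ∈ P) {f : U} (hf : f ∈ P)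
    (hf' : f ∉ p • (⊤ : Submodule Z U)) :
    ∃ (D : ℕ) (w : ℤ → ℕ), ∀ n : ℕ,
      wordSpan Z I e (fun u => listWeight w u ≤ n) ≤ primeSaturation p (P.toSubmodule Z ⊔
        Submodule.span Z (Set.range
          fun b : Fin D → Finset.Icc (-(n : ℤ)) n × Finset.range (n + 1) =>
            word e (expandList fun i => ((b i).1, (b i).2)))) := by
  obtain ⟨D, κ, C, hD⟩ := exists_isReducibleWord_of_card h hZ hpP hf hf'
  refine ⟨D, thresholdWeight κ C, fun n => wordSpan_le fun l => ?_⟩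
  set X := primeSaturation p (P.toSubmodule Z ⊔ Submodule.span Z (Set.range
    fun b : Fin D → Finset.Icc (-(n : ℤ)) n × Finset.range (n + 1) =>
      word e (expandList fun i => ((b i).1, (b i).2))))
  induction l using (isLowerWord_wellFounded κ C).induction with
  | _ l ih =>
  intro hl hn
  -- Lower words are no heavier, so the induction never leaves the words of weight at most `n`.
  have hlow : wordSpan Z I e (IsLowerWord κ C l) ≤ X := wordSpan_le fun u hu hul =>
    ih u hul hu (le_trans (hul.elim le_of_lt fun h => h.1.le) hn)
  by_cases hcard : l.toFinset.card ≤ D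
  -- Each letter weighs more than its absolute value, so weight at most `n` bounds both the letters
  -- and the multiplicities by `n`.
  · have hw : ∀ l : List ℤ, l.length ≤ listWeight (thresholdWeight κ C) l ∧
        ∀ i ∈ l, i.natAbs ≤ listWeight (thresholdWeight κ C) l := by
      intro l
      induction l with
      | nil => simp
      | cons i l ih =>
        have hi : i.natAbs + 1 ≤ thresholdWeight κ C i := by
          rw [thresholdWeight]; omega
        rw [List.length_cons, listWeight_cons]
        refine ⟨by omega, fun j hj => ?_⟩
        rcases List.mem_cons.mp hj with rfl | hj
        · omega
        · exact (ih.2 j hj).trans (by omega)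
    obtain ⟨b, hb, hperm⟩ := exists_perm_expandList hcard (fun i hi => ((hw l).2 i hi).trans hn)
      ((hw l).1.trans hn)
    rw [← sub_add_cancel (word e l) (word e (expandList b))]
    refine add_mem (hlow (wordSpan_mono (fun u hu => Or.inl hu)
      (word_perm_sub_mem h (thresholdWeight_strictSubadditive κ C) hperm hl))) ?_
    refine le_primeSaturation _ (Submodule.mem_sup_right (Submodule.subset_span ?_))
    exact ⟨fun i => (⟨_, (hb i).1⟩, ⟨_, (hb i).2⟩), rfl⟩
  · obtain ⟨s, hs, y, hy, hsy⟩ := hD l hl (by omega)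
    refine mem_primeSaturation_of_smul_mem hs ?_
    rw [← sub_add_cancel (s • word e l) y]
    exact add_mem (hlow hsy) (le_primeSaturation _ (Submodule.mem_sup_left hy))

end GoodWords

/-! ### Growth from below, and stabilisation of chains. -/

section Chains

variable {Z U : Type*} [CommRing Z] [Ring U] [Algebra Z U] {I : Set ℤ} {e : ℤ → U}
  {p : Ideal Z}

theorem exists_mem_wordSpan_le (h : IsWittSystem Z I e) (w : ℤ → ℕ) (x : U) :
    ∃ m, x ∈ wordSpan Z I e fun u => listWeight w u ≤ m := by
  have hx := mem_wordSpan_true h x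
  have hmono : ∀ {m m' : ℕ}, m ≤ m' → wordSpan Z I e (fun u => listWeight w u ≤ m) ≤
      wordSpan Z I e fun u => listWeight w u ≤ m' := fun h => wordSpan_mono fun u hu => hu.trans h
  induction hx using Submodule.span_induction with
  | mem x hx =>
    obtain ⟨l, hl, -, rfl⟩ := hx
    exact ⟨_, word_mem_wordSpan hl le_rfl⟩
  | zero => exact ⟨0, zero_mem _⟩
  | add x y _ _ hx hy =>
    obtain ⟨m, hm⟩ := hx
    obtain ⟨m', hm'⟩ := hy
    exact ⟨max m m', add_mem (hmono (le_max_left _ _) hm) (hmono (le_max_right _ _) hm')⟩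
  | smul z x _ hx =>
    obtain ⟨m, hm⟩ := hx
    exact ⟨m, Submodule.smul_mem _ _ hm⟩

theorem pow_mem_wordSpan {w : ℤ → ℕ} {m : ℕ} {a : U}
    (ha : a ∈ wordSpan Z I e fun u => listWeight w u ≤ m) (i : ℕ) :
    a ^ i ∈ wordSpan Z I e fun u => listWeight w u ≤ i * m := by
  induction i with
  | zero =>
    rw [pow_zero, ← word_nil (e := e)]
    exact word_mem_wordSpan (by simp) (by simp)
  | succ i ih =>
    rw [pow_succ]
    refine mul_mem_wordSpan (fun l l' hl hl' => ?_) ih ha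
    rw [listWeight_append, Nat.succ_mul]
    exact Nat.add_le_add hl hl'

/-- Induction on the degree `j`: choose a later member `P n ≠ P N`, an element `a ∈ P n \ P N`, and
multiply a family of size `x ^ j` independent modulo `P n` by `a ^ i` for `i < x`. The weight stays
linear in `x`. The base family `1` is independent because `P N` contracts to `p`. -/
theorem exists_independentModulo (h : IsWittSystem Z I e) {P : ℕ → TwoSidedIdeal U}
    (hmono : Monotone P) (hP : ∀ n, IsCompletelyPrime (P n))
    (hp : ∀ n z, algebraMap Z U z ∈ P n ↔ z ∈ p) (hne : ∀ N, ∃ n, N ≤ n ∧ P n ≠ P N)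
    (w : ℤ → ℕ) (j N : ℕ) :
    ∃ μ : ℕ, ∀ x : ℕ, ∃ (ι : Type) (_ : Fintype ι) (b : ι → U), Fintype.card ι = x ^ j ∧
      (∀ i, b i ∈ wordSpan Z I e fun u => listWeight w u ≤ μ * x) ∧
      IndependentModulo p (P N) b := by
  induction j generalizing N with
  | zero =>
    refine ⟨0, fun x => ⟨Unit, inferInstance, fun _ => 1, by simp, fun _ => ?_, fun z hz i => ?_⟩⟩
    · rw [← word_nil (e := e)]
      exact word_mem_wordSpan (by simp) (by simp)
    · rw [← hp N, Algebra.algebraMap_eq_smul_one]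
      simpa using hz
  | succ j ih =>
    obtain ⟨n, hNn, hn⟩ := hne N
    obtain ⟨a, han, haN⟩ := Set.exists_of_ssubset
      ((TwoSidedIdeal.lt_iff _ _).mp (lt_of_le_of_ne (hmono hNn) hn.symm))
    obtain ⟨μ, hμ⟩ := ih n
    obtain ⟨m, hm⟩ := exists_mem_wordSpan_le h w a
    refine ⟨m + μ, fun x => ?_⟩
    obtain ⟨ι, _, b, hcard, hb, hind⟩ := hμ x
    refine ⟨Fin x × ι, inferInstance, fun q => a ^ (q.1 : ℕ) * b q.2, ?_, fun q => ?_,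
      hind.pow_mul (hP N) (hmono hNn) (fun z hz => (hp N z).mpr hz) han haN x⟩
    · rw [Fintype.card_prod, Fintype.card_fin, hcard, pow_succ']
    · refine mul_mem_wordSpan (fun l l' hl hl' => ?_) (pow_mem_wordSpan hm q.1) (hb q.2)
      have h1 : (q.1 : ℕ) * m ≤ x * m := Nat.mul_le_mul_right _ q.1.2.le
      rw [listWeight_append, add_mul]
      refine Nat.add_le_add (hl.trans (h1.trans_eq (mul_comm _ _))) hl'

theorem stabilizes_of_algebraMap_mem_iff (h : IsWittSystem Z I e)
    (hZ : ∀ m : ℤ, m ≠ 0 → IsUnit (m : Z)) [p.IsPrime] {P : ℕ → TwoSidedIdeal U}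
    (hmono : Monotone P) (hP : ∀ n, IsCompletelyPrime (P n))
    (hp : ∀ n z, algebraMap Z U z ∈ P n ↔ z ∈ p) : ∃ N, ∀ n, N ≤ n → P n = P N := by
  by_contra! hne
  by_cases htriv : ∀ n, ∀ f ∈ P n, f ∈ p • (⊤ : Submodule Z U)
  -- Here every `P n` equals `p • ⊤`, so the chain is constant.
  · obtain ⟨n, -, hn⟩ := hne 0
    have heq : ∀ n f, f ∈ P n ↔ f ∈ p • (⊤ : Submodule Z U) := fun n f => by
      refine ⟨htriv n f, fun hf => ?_⟩
      suffices hle : p • (⊤ : Submodule Z U) ≤ (P n).toSubmodule Z from hle hf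
      refine Submodule.smul_le.mpr fun z hz x _ => ?_
      rw [Algebra.smul_def]
      exact (P n).mul_mem_right _ _ ((hp n z).mpr hz)
    exact hn (TwoSidedIdeal.ext fun f => (heq n f).trans (heq 0 f).symm)
  · push Not at htriv
    obtain ⟨N, f, hf, hf'⟩ := htriv
    have hpN : ∀ z ∈ p, algebraMap Z U z ∈ P N := fun z hz => (hp N z).mpr hz
    obtain ⟨D, w, hD⟩ := exists_wordSpan_le h hZ hpN hf hf'
    obtain ⟨μ, hμ⟩ := exists_independentModulo h hmono hP hp hne w (2 * D + 1) N
    -- For `x ≥ 1` the upper bound at weight `μ * x` is at most `(c * x ^ 2) ^ D`. Against `x ^ (2 *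
    -- D + 1)` independent elements this gives `x ≤ c ^ D`, which the choice of `x` violates.
    set c := (2 * μ + 1) * (μ + 1)
    set x := c ^ D + 1
    obtain ⟨ι, _, b, hcard, hb, hind⟩ := hμ x
    have hle := hind.card_le _ hpN fun i => hD _ (hb i)
    rw [hcard] at hle
    simp only [Fintype.card_pi, Fintype.card_prod, Fintype.card_coe, Finset.card_range,
      Int.card_Icc, Finset.prod_const, Finset.card_univ, Fintype.card_fin] at hle
    have h1 : (((μ * x : ℕ) : ℤ) + 1 - -((μ * x : ℕ) : ℤ)).toNat * (μ * x + 1) ≤ c * x ^ 2 := by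
      have h2 : (((μ * x : ℕ) : ℤ) + 1 - -((μ * x : ℕ) : ℤ)).toNat = 2 * (μ * x) + 1 := by omega
      rw [h2]
      calc (2 * (μ * x) + 1) * (μ * x + 1) ≤ (2 * (μ * x) + x) * (μ * x + x) := by
            gcongr <;> omega
        _ = c * x ^ 2 := by ring
    have h3 := hle.trans (Nat.pow_le_pow_left h1 D)
    rw [mul_pow, ← pow_mul, pow_succ', Nat.mul_le_mul_right_iff (by positivity)] at h3
    omega

theorem IsCompletelyPrime.one_notMem {P : TwoSidedIdeal U} (hP : IsCompletelyPrime P) :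
    (1 : U) ∉ P := fun h1 => hP.ne_top (P.one_mem_iff.mp h1)

/-- An algebra over a noetherian ring containing the rational numbers that is generated by a Witt
system satisfies the ascending chain condition on completely prime ideals. -/
theorem IsWittSystem.accCompletelyPrime [IsNoetherianRing Z] (h : IsWittSystem Z I e)
    (hZ : ∀ m : ℤ, m ≠ 0 → IsUnit (m : Z)) : ACCCompletelyPrime U := by
  intro P hmono hP
  -- The contractions of the `P n` to `Z` form an ascending chain of ideals; from `N` on they equal
  -- one prime `p`.
  obtain ⟨N, hN⟩ := monotone_stabilizes_iff_noetherian.mpr ‹IsNoetherianRing Z›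
    ⟨fun n => ((P n).toSubmodule Z).comap (Algebra.linearMap Z U),
      fun m n hmn z hz => hmono hmn hz⟩
  set p : Ideal Z := ((P N).toSubmodule Z).comap (Algebra.linearMap Z U)
  have hprime : p.IsPrime := by
    refine ⟨fun htop => (hP N).one_notMem ?_, fun {x y} hxy => (hP N).mem_or_mem ?_⟩
    · have : (1 : Z) ∈ p := htop ▸ trivial
      rw [← map_one (algebraMap Z U)]
      exact this
    · have : algebraMap Z U (x * y) ∈ P N := hxy
      rwa [map_mul] at this
  obtain ⟨M, hM⟩ := stabilizes_of_algebraMap_mem_iff h hZ (p := p) (P := fun n => P (N + n))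
    (fun m n hmn => hmono (by omega)) (fun n => hP _)
    fun n z => (SetLike.ext_iff.mp (hN (N + n) (by omega)) z).symm
  refine ⟨N + M, fun n hn => ?_⟩
  have := hM (n - N) (by omega)
  rwa [show N + (n - N) = n by omega] at this

end Chains

/-! ### The three enveloping algebras as Witt systems. -/

section Instances

attribute [local instance 100] LieRing.ofAssociativeRing

/-- The map `ι` corestricts to the subalgebra it generates; by the universal property the induced
map, followed by the inclusion, is the identity. -/
theorem UniversalEnvelopingAlgebra.adjoin_range_ι (K L : Type*) [CommRing K] [LieRing L]
    [LieAlgebra K L] :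
    Algebra.adjoin K (Set.range (UniversalEnvelopingAlgebra.ι K : L → _)) = ⊤ := by
  set S := Algebra.adjoin K (Set.range (UniversalEnvelopingAlgebra.ι K : L → _))
  let f : L →ₗ⁅K⁆ S :=
    { toFun := fun x => ⟨UniversalEnvelopingAlgebra.ι K x, Algebra.subset_adjoin ⟨x, rfl⟩⟩
      map_add' := fun x y => Subtype.ext (map_add _ x y)
      map_smul' := fun r x => Subtype.ext (map_smul _ r x)
      map_lie' := fun {x y} => Subtype.ext (LieHom.map_lie _ x y) }
  have hf : S.val.comp (UniversalEnvelopingAlgebra.lift K f) = AlgHom.id K _ := by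
    refine UniversalEnvelopingAlgebra.hom_ext K (LieHom.ext fun x => ?_)
    change ((UniversalEnvelopingAlgebra.lift K f) (UniversalEnvelopingAlgebra.ι K x) :
      UniversalEnvelopingAlgebra K L) = UniversalEnvelopingAlgebra.ι K x
    rw [UniversalEnvelopingAlgebra.lift_ι_apply]
    rfl
  refine top_le_iff.mp fun x _ => ?_
  rw [← AlgHom.id_apply (R := K) x, ← hf]
  exact (UniversalEnvelopingAlgebra.lift K f x).2

theorem UniversalEnvelopingAlgebra.adjoin_ι_eq_top {K L : Type*} [CommRing K] [LieRing L]
    [LieAlgebra K L] {s : Set L} (hs : Submodule.span K s = ⊤) :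
    Algebra.adjoin K (UniversalEnvelopingAlgebra.ι K '' s) = ⊤ := by
  refine top_le_iff.mp (adjoin_range_ι K L ▸ Algebra.adjoin_le ?_)
  rintro _ ⟨x, rfl⟩
  have hx : x ∈ Submodule.span K s := hs ▸ trivial
  induction hx using Submodule.span_induction with
  | mem x hx => exact Algebra.subset_adjoin ⟨x, hx, rfl⟩
  | zero => rw [map_zero]; exact zero_mem _
  | add x y _ _ hx hy => rw [map_add]; exact add_mem hx hy
  | smul r x _ hx => rw [map_smul]; exact Subalgebra.smul_mem _ hx r

theorem UniversalEnvelopingAlgebra.ι_commutator {K L : Type*} [CommRing K] [LieRing L]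
    [LieAlgebra K L] (x y : L) :
    ι K x * ι K y - ι K y * ι K x = ι K ⁅x, y⁆ := by
  rw [LieHom.map_lie, LieRing.of_associative_ring_bracket]

theorem VirasoroAlgebra.span_eq_top (K : Type*) [Field K] :
    Submodule.span K (insert (VirasoroAlgebra.c K) (Set.range (VirasoroAlgebra.e K))) = ⊤ := by
  refine top_le_iff.mp fun x _ => ?_
  let inl : WittAlgebra K →ₗ[K] VirasoroAlgebra K := LinearMap.inl K (WittAlgebra K) K
  have h1 : ∀ y : WittAlgebra K, inl y ∈
      Submodule.span K (insert (VirasoroAlgebra.c K) (Set.range (VirasoroAlgebra.e K))) := by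
    intro y
    induction y using WittAlgebra.induction_e with
    | zero => rw [map_zero]; exact zero_mem _
    | add y z hy hz => rw [map_add]; exact add_mem hy hz
    | smul r y hy => rw [map_smul]; exact Submodule.smul_mem _ r hy
    | e n => exact Submodule.subset_span (Or.inr ⟨n, rfl⟩)
  have h2 : x = inl x.1 + x.2 • VirasoroAlgebra.c K := by
    refine Prod.ext ?_ ?_
    · change x.1 = x.1 + x.2 • (0 : WittAlgebra K)
      rw [smul_zero, add_zero]
    · change x.2 = 0 + x.2 • (1 : K)
      rw [smul_eq_mul, mul_one, zero_add]
  rw [h2]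
  exact add_mem (h1 _) (Submodule.smul_mem _ _ (Submodule.subset_span (Or.inl rfl)))

variable (K : Type*) [Field K] [CharZero K]

theorem isUnit_intCast_of_ne_zero {m : ℤ} (hm : m ≠ 0) : IsUnit (m : K) :=
  (Int.cast_ne_zero.mpr hm).isUnit

theorem WittAlgebra.isWittSystem :
    IsWittSystem K Set.univ fun i => UniversalEnvelopingAlgebra.ι K (WittAlgebra.e K i) := by
  have hlie : ∀ i j : ℤ, UniversalEnvelopingAlgebra.ι K (WittAlgebra.e K i) *
      UniversalEnvelopingAlgebra.ι K (WittAlgebra.e K j) -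
      UniversalEnvelopingAlgebra.ι K (WittAlgebra.e K j) *
      UniversalEnvelopingAlgebra.ι K (WittAlgebra.e K i) =
        (j - i) • UniversalEnvelopingAlgebra.ι K (WittAlgebra.e K (i + j)) := fun i j => by
    rw [UniversalEnvelopingAlgebra.ι_commutator, WittAlgebra.lie_e, map_smul, ← Int.cast_sub,
      Int.cast_smul_eq_zsmul]
  refine ⟨fun _ _ => trivial, fun _ _ _ => trivial, fun _ _ _ => trivial,
    fun {i j} _ _ => ⟨0, by rw [hlie, map_zero, add_zero]⟩, fun {i j} _ _ _ => hlie i j, ?_⟩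
  rw [Set.image_univ, ← Function.comp_def, Set.range_comp]
  exact UniversalEnvelopingAlgebra.adjoin_ι_eq_top (WittAlgebra.basis K).span_eq

/-- The basis vector `e n` of the positive Witt algebra, for `n ≥ 1`. -/
noncomputable def positiveWittAlgebra.e (n : ℤ) : positiveWittAlgebra K :=
  if h : 1 ≤ n then ⟨WittAlgebra.e K n, Submodule.subset_span ⟨n, h, rfl⟩⟩ else 0

variable {K} in
theorem positiveWittAlgebra.coe_e {n : ℤ} (h : 1 ≤ n) :
    (positiveWittAlgebra.e K n : WittAlgebra K) = WittAlgebra.e K n := by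
  rw [positiveWittAlgebra.e, dif_pos h]

theorem positiveWittAlgebra.isWittSystem :
    IsWittSystem K (Set.Ici 1)
      fun i => UniversalEnvelopingAlgebra.ι K (positiveWittAlgebra.e K i) := by
  have hlie : ∀ i j : ℤ, 1 ≤ i → 1 ≤ j →
      UniversalEnvelopingAlgebra.ι K (positiveWittAlgebra.e K i) *
      UniversalEnvelopingAlgebra.ι K (positiveWittAlgebra.e K j) -
      UniversalEnvelopingAlgebra.ι K (positiveWittAlgebra.e K j) *
      UniversalEnvelopingAlgebra.ι K (positiveWittAlgebra.e K i) =
        (j - i) • UniversalEnvelopingAlgebra.ι K (positiveWittAlgebra.e K (i + j)) := by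
    intro i j hi hj
    have h1 : ⁅positiveWittAlgebra.e K i, positiveWittAlgebra.e K j⁆ =
        ((j - i : ℤ) : K) • positiveWittAlgebra.e K (i + j) := Subtype.ext <| by
      change ⁅(positiveWittAlgebra.e K i : WittAlgebra K), (positiveWittAlgebra.e K j : WittAlgebra K)⁆ =
        ((j - i : ℤ) : K) • (positiveWittAlgebra.e K (i + j) : WittAlgebra K)
      rw [coe_e hi, coe_e hj, coe_e (by omega), WittAlgebra.lie_e, Int.cast_sub]
    rw [UniversalEnvelopingAlgebra.ι_commutator, h1, map_smul, Int.cast_smul_eq_zsmul]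
  refine ⟨fun {i j} hi hj => ?_, fun {i j} _ _ hj => ?_, fun {i j} hi h0 _ => ?_,
    fun {i j} hi hj => ⟨0, by rw [hlie i j hi hj, map_zero, add_zero]⟩,
    fun {i j} hi hj _ => hlie i j hi hj, ?_⟩
  · simp only [Set.mem_Ici] at *; omega
  · simp only [Set.mem_Ici] at *; omega
  · simp only [Set.mem_Ici] at *; omega
  have key := UniversalEnvelopingAlgebra.adjoin_ι_eq_top
    (s := positiveWittAlgebra.e K '' Set.Ici 1) (Submodule.map_injective_of_injective
      (f := (positiveWittAlgebra K).toSubmodule.subtype) Subtype.val_injective ?_)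
  · rwa [Set.image_image] at key
  rw [Submodule.map_span, Submodule.map_top, Submodule.range_subtype]
  refine congrArg _ (Set.ext fun x => ⟨?_, ?_⟩)
  · rintro ⟨_, ⟨n, hn, rfl⟩, rfl⟩
    exact ⟨n, hn, coe_e hn⟩
  · rintro ⟨n, hn, rfl⟩
    exact ⟨_, ⟨n, hn, rfl⟩, coe_e hn⟩

theorem VirasoroAlgebra.commute_ι_c (x : UniversalEnvelopingAlgebra K (VirasoroAlgebra K)) :
    Commute (UniversalEnvelopingAlgebra.ι K (VirasoroAlgebra.c K)) x := by
  have hx : x ∈ Algebra.adjoin K (Set.range (UniversalEnvelopingAlgebra.ι K)) :=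
    UniversalEnvelopingAlgebra.adjoin_range_ι K (VirasoroAlgebra K) ▸ Algebra.mem_top
  induction hx using Algebra.adjoin_induction with
  | mem x hx =>
    obtain ⟨y, rfl⟩ := hx
    have := UniversalEnvelopingAlgebra.ι_commutator (K := K) y (VirasoroAlgebra.c K)
    rw [VirasoroAlgebra.lie_c, map_zero, sub_eq_zero] at this
    exact this.symm
  | algebraMap r => exact (Algebra.commutes r _).symm
  | add x y _ _ hx hy => exact hx.add_right hy
  | mul x y _ _ hx hy => exact hx.mul_right hy

/-- The enveloping algebra of the Virasoro algebra as an algebra over the polynomial ring in the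
central element `c`. -/
@[reducible] noncomputable def VirasoroAlgebra.polynomialAlgebra :
    Algebra (Polynomial K) (UniversalEnvelopingAlgebra K (VirasoroAlgebra K)) :=
  (Polynomial.aeval (UniversalEnvelopingAlgebra.ι K (VirasoroAlgebra.c K))).toRingHom.toAlgebra'
    fun f x => by
      induction f using Polynomial.induction_on' with
      | add f g hf hg => rw [map_add, add_mul, mul_add, hf, hg]
      | monomial n a =>
        change Polynomial.aeval _ (Polynomial.monomial n a) * x =
          x * Polynomial.aeval _ (Polynomial.monomial n a)
        rw [Polynomial.aeval_monomial]
        exact (Commute.mul_left (Algebra.commutes a x)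
          ((VirasoroAlgebra.commute_ι_c K x).pow_left n)).eq

attribute [local instance] VirasoroAlgebra.polynomialAlgebra

theorem VirasoroAlgebra.algebraMap_polynomial (f : Polynomial K) :
    algebraMap (Polynomial K) (UniversalEnvelopingAlgebra K (VirasoroAlgebra K)) f =
      Polynomial.aeval (UniversalEnvelopingAlgebra.ι K (VirasoroAlgebra.c K)) f := rfl

/-- Over `K[c]` the cocycle term becomes a scalar, present only when `i + j = 0`, and `c` itself is
no longer needed as a generator. -/
theorem VirasoroAlgebra.isWittSystem :
    IsWittSystem (Polynomial K) Set.univ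
      fun i => UniversalEnvelopingAlgebra.ι K (VirasoroAlgebra.e K i) := by
  have hlie : ∀ i j : ℤ, UniversalEnvelopingAlgebra.ι K (VirasoroAlgebra.e K i) *
      UniversalEnvelopingAlgebra.ι K (VirasoroAlgebra.e K j) -
      UniversalEnvelopingAlgebra.ι K (VirasoroAlgebra.e K j) *
      UniversalEnvelopingAlgebra.ι K (VirasoroAlgebra.e K i) =
        (j - i) • UniversalEnvelopingAlgebra.ι K (VirasoroAlgebra.e K (i + j)) +
        algebraMap (Polynomial K) _
          (Polynomial.monomial 1 (if i + j = 0 then ((i : K) ^ 3 - (i : K)) / 12 else 0)) := by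
    intro i j
    rw [UniversalEnvelopingAlgebra.ι_commutator, VirasoroAlgebra.lie_e, map_add, map_smul,
      map_smul, ← Int.cast_sub, Int.cast_smul_eq_zsmul, VirasoroAlgebra.algebraMap_polynomial,
      Polynomial.aeval_monomial, pow_one, ← Algebra.smul_def]
  refine ⟨fun _ _ => trivial, fun _ _ _ => trivial, fun _ _ _ => trivial,
    fun {i j} _ _ => ⟨_, hlie i j⟩, fun {i j} _ _ hij => ?_, ?_⟩
  · rw [hlie, if_neg hij, map_zero, map_zero, add_zero]
  · rw [Set.image_univ]
    refine top_le_iff.mp ?_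
    rintro x -
    have hx : x ∈ Algebra.adjoin K (UniversalEnvelopingAlgebra.ι K ''
        insert (VirasoroAlgebra.c K) (Set.range (VirasoroAlgebra.e K))) :=
      UniversalEnvelopingAlgebra.adjoin_ι_eq_top (VirasoroAlgebra.span_eq_top K) ▸ Algebra.mem_top
    induction hx using Algebra.adjoin_induction with
    | mem x hx =>
      obtain ⟨x, rfl | ⟨n, rfl⟩, rfl⟩ := hx
      · rw [← Polynomial.aeval_X (R := K) (UniversalEnvelopingAlgebra.ι K (VirasoroAlgebra.c K)),
          ← VirasoroAlgebra.algebraMap_polynomial]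
        exact Subalgebra.algebraMap_mem _ _
      · exact Algebra.subset_adjoin ⟨n, rfl⟩
    | algebraMap r =>
      rw [← Polynomial.aeval_C (UniversalEnvelopingAlgebra.ι K (VirasoroAlgebra.c K)),
        ← VirasoroAlgebra.algebraMap_polynomial]
      exact Subalgebra.algebraMap_mem _ _
    | add x y _ _ hx hy => exact add_mem hx hy
    | mul x y _ _ hx hy => exact mul_mem hx hy

end Instances

/-- Over a field `K` of characteristic zero, the universal enveloping algebras `U(W₊)`, `U(W)` and
`U(Vir)` satisfy the ascending chain condition on completely prime ideals. -/
theorem mainTheorem6 (K : Type*) [Field K] [CharZero K] :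
    ACCCompletelyPrime (UniversalEnvelopingAlgebra K (positiveWittAlgebra K)) ∧
      ACCCompletelyPrime (UniversalEnvelopingAlgebra K (WittAlgebra K)) ∧
      ACCCompletelyPrime (UniversalEnvelopingAlgebra K (VirasoroAlgebra K)) := by
  refine ⟨(positiveWittAlgebra.isWittSystem K).accCompletelyPrime
      fun m hm => isUnit_intCast_of_ne_zero K hm,
    (WittAlgebra.isWittSystem K).accCompletelyPrime fun m hm => isUnit_intCast_of_ne_zero K hm, ?_⟩
  let := VirasoroAlgebra.polynomialAlgebra K
  refine (VirasoroAlgebra.isWittSystem K).accCompletelyPrime fun m hm => ?_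
  simpa using (isUnit_intCast_of_ne_zero K hm).map Polynomial.C
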